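/- Let $S$ be a countable set of signal names and let $\mathit{Int}=\mathit{Input}\cup\mathit{Output}\subseteq S$ be such that $S\setminus\mathit{Int}$ is infinite. All terms are taken up to renaming of bound signal names, and $;$ is taken up to associativity. **Source language.** Threads are $T::=0\mid T;T\mid \mathsf{emit}\,s\mid \nu s\,T\mid \mathsf{thread}\,T\mid \mathsf{await}\,s\mid \mathsf{watch}\,s\,T\mid A(\vec s)$, where each identifier $A$ has exactly one equation $A(\vec x)=T$ in which the free signal names $\mathrm{sig}(T)$ of $T$ are among $\vec x$. For an environment $E$ (a partial function from $S$ to $\{\mathit{true},\mathit{false}\}$), the reduction $(T,E)\xrightarrow{P}(T',E')$, with $P$ the multiset of spawned threads, is given by $(0;T,E)\xrightarrow{\emptyset}(T,E)$; $(\mathsf{emit}\,s,E)\xrightarrow{\emptyset}(0,E[\mathit{true}/s])$; $(\mathsf{watch}\,s\,0,E)\xrightarrow{\emptyset}(0,E)$; $(\nu s\,T,E)\xrightarrow{\emptyset}(T,E[\mathit{false}/s])$ if $s\notin\mathrm{dom}(E)$; $(A(\vec s),E)\xrightarrow{\emptyset}([\vec s/\vec x]T,E)$ if $A(\vec x)=T$;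 $(\mathsf{await}\,s,E)\xrightarrow{\emptyset}(0,E)$ if $E(s)=\mathit{true}$; $(\mathsf{thread}\,T,E)\xrightarrow{\{T\}}(0,E)$; and it is closed under the evaluation contexts generated by $[\,]$, $C;T$ and $\mathsf{watch}\,s\,C$. On suspended (irreducible) threads the evaluation at the end of the instant is $\lfloor 0\rfloor_E=0$, $\lfloor T;T'\rfloor_E=\lfloor T\rfloor_E;T'$, $\lfloor\mathsf{await}\,s\rfloor_E=\mathsf{await}\,s$, and $\lfloor\mathsf{watch}\,s\,T\rfloor_E=0$ if $E(s)=\mathit{true}$, $=\mathsf{watch}\,s\,\lfloor T\rfloor_E$ otherwise. **Target language.** Tail recursive threads are $t::=0\mid A(\vec s)\mid \mathsf{emit}\,s.t\mid \nu s\,t\mid\mathsf{thread}\,t.t\mid\mathsf{present}\,s\,t\,b$ with branching threads $b::=t\mid\mathsf{ite}\,s\,b\,b$, again with one equation per identifier. Reduction: $(\mathsf{emit}\,s.t,E)\xrightarrow{\emptyset}(t,E[\mathit{true}/s])$; $(\nu s\,t,E)\xrightarrow{\emptyset}(t,E[\mathit{false}/s])$ if $s\notin\mathrm{dom}(E)$;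 $(A(\vec s),E)\xrightarrow{\emptyset}([\vec s/\vec x]t,E)$ if $A(\vec x)=t$; $(\mathsf{present}\,s\,t\,b,E)\xrightarrow{\emptyset}(t,E)$ if $E(s)=\mathit{true}$; $(\mathsf{thread}\,t'.t,E)\xrightarrow{\{t'\}}(t,E)$. At the end of the instant $\lfloor 0\rfloor_E=0$ and $\lfloor\mathsf{present}\,s\,t\,b\rfloor_E=\langle b\rangle_E$, where $\langle t\rangle_E=t$, and $\langle\mathsf{ite}\,s\,b_1\,b_2\rangle_E$ is $\langle b_1\rangle_E$ if $E(s)=\mathit{true}$ and $\langle b_2\rangle_E$ if $E(s)=\mathit{false}$. **Programs and traces** (for both languages). A program is a finite non-empty multiset of threads; $(P\cup\{T\},E)\to(P\cup\{T'\}\cup P'',E')$ if $(T,E)\xrightarrow{P''}(T',E')$; $(P,E)$ is suspended if each of its threads is irreducible in $E$. For $I\subseteq\mathit{Input}$ let $E_{I,P}$ be true on $I$, false on $(\mathit{Int}\cup\mathrm{sig}(P))\setminus I$ and undefined elsewhere. Then $P\xrightarrow{I/O}\lfloor P'\rfloor_{E'}$ holds if $(P,E_{I,P})\to^*(P',E')$,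 $(P',E')$ is suspended and $O=\{s\in\mathit{Output}\mid E'(s)=\mathit{true}\}$. A complete run of $P$ is a sequence of transitions $P\xrightarrow{I_1/O_1}P_1\xrightarrow{I_2/O_2}\cdots$ that is infinite, or finite and not extendable, and $\mathrm{tr}(P)$ is the set of the finite or infinite words $(I_1/O_1)(I_2/O_2)\cdots$ of the complete runs of $P$. **CPS translation.** For a tail recursive thread $t$ and a sequence $\tau=(s_1,t_1)\cdots(s_m,t_m)$ of signals and tail recursive threads, define $[\![0]\!](t,\tau)=t$; $[\![T_1;T_2]\!](t,\tau)=[\![T_1]\!]([\![T_2]\!](t,\tau),\tau)$; $[\![\mathsf{emit}\,s]\!](t,\tau)=\mathsf{emit}\,s.t$; $[\![\nu s\,T]\!](t,\tau)=\nu s\,[\![T]\!](t,\tau)$ with $s$ not free in $t,\tau$; $[\![\mathsf{thread}\,T]\!](t,\tau)=\mathsf{thread}\,[\![T]\!](0,\epsilon).t$; $[\![\mathsf{watch}\,s\,T]\!](t,\tau)=[\![T]\!](t,\tau\cdot(s,t))$; $[\![\mathsf{await}\,s]\!](t,\tau)=\mathsf{present}\,s\,t\,b$ with $b=\mathsf{ite}\,s_1\,t_1(\cdots(\mathsf{ite}\,s_m\,t_m\,B)\cdots)$,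 where $B$ is an identifier whose parameters are the free names of $s,t,\tau$ and whose equation is $B=\mathsf{present}\,s\,t\,b$; $[\![A(\vec s)]\!](t,\tau)=A^{(t,\tau)}(\vec s,\vec s')$, where $\vec s'$ lists the names free in $(t,\tau)$ and $A^{(t,\tau)}$ is an identifier with equation $A^{(t,\tau)}(\vec x,\vec s')=[\![T]\!](t,\tau)$ if $A(\vec x)=T$, $\{\vec x\}\cap\{\vec s'\}=\emptyset$. The system of equations for the identifiers $B$ and $A^{(t,\tau)}$ may be infinite. For a program $P$ let $[\![P]\!]$ be the multiset of the $[\![T]\!](0,\epsilon)$ for $T\in P$. **Theorem.** For every system of source equations and every source program $P$, $\mathrm{tr}(P)=\mathrm{tr}([\![P]\!])$. -/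

import Mathlib

namespace SL

/-! ### Environments and the layer common to the two languages -/

/-- Environments: partial functions from signal names to booleans (`none` is "undefined"). -/
abbrev Env (S : Type) : Type := S → Option Bool

/-- `E[b/s]`. -/
noncomputable def Env.set {S : Type} (E : Env S) (s : S) (b : Bool) : Env S :=
  open Classical in Function.update E s (some b)

/-- What the program level needs to know about a language of threads over the signal names `S`:
the free signal names of a thread, the small step reduction `(T, E) -[P]→ (T', E')`, where `P` is
the multiset of spawned threads, and the evaluation `⌊T⌋_E` at the end of the instant. It is only
used for the two languages `highLevel` and `tailRec` below. -/
structure Language (S : Type) where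
  Thr : Type 1
  names : Thr → List S
  step : Thr → Env S → Multiset Thr → Thr → Env S → Prop
  endInstant : Env S → Thr → Thr

section Programs

variable {S : Type} (L : Language S)

/-- One scheduling step `(P, E) → (P', E')` of a program. -/
inductive ProgStep : Multiset L.Thr × Env S → Multiset L.Thr × Env S → Prop
  | mk {P : Multiset L.Thr} {T T' : L.Thr} {E E' : Env S} {P'' : Multiset L.Thr}
      (h : L.step T E P'' T' E') : ProgStep (P + {T}, E) (P + {T'} + P'', E')

/-- `(P, E)↓`: no thread of `P` can be reduced in `E`. -/
def Suspended (P : Multiset L.Thr) (E : Env S) : Prop :=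
  ∀ T ∈ P, ∀ P'' T' E', ¬ L.step T E P'' T' E'

/-- `sig(P)`. -/
def sigProg (P : Multiset L.Thr) : Set S := {s | ∃ T ∈ P, s ∈ L.names T}

/-- The environment `E_{I,P}` at the beginning of an instant. -/
noncomputable def initEnv (Input Output I : Set S) (P : Multiset L.Thr) : Env S := fun s =>
  open Classical in
  if s ∈ I then some true
  else if s ∈ Input ∪ Output ∪ sigProg L P then some false
  else none

/-- The transition `P -[I/O]→ P'` of one instant; the label is the pair `(I, O)`. -/
def IOStep (Input Output : Set S) (P : Multiset L.Thr) (a : Set S × Set S)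
    (P' : Multiset L.Thr) : Prop :=
  a.1 ⊆ Input ∧ ∃ (Q : Multiset L.Thr) (E' : Env S),
    Relation.ReflTransGen (ProgStep L) (P, initEnv L Input Output a.1 P) (Q, E') ∧
    Suspended L Q E' ∧
    a.2 = {s | s ∈ Output ∧ E' s = some true} ∧
    P' = Q.map (L.endInstant E')

end Programs

/-- Finite or infinite words. -/
inductive Word (α : Type) : Type
  | finite (w : List α) : Word α
  | infinite (w : ℕ → α) : Word α

/-- Finite runs `P -[I₁/O₁]→ P₁ ⋯ -[Iₙ/Oₙ]→ Pₙ`. -/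
inductive Run {S : Type} (L : Language S) (Input Output : Set S) :
    Multiset L.Thr → List (Set S × Set S) → Multiset L.Thr → Prop
  | nil (P : Multiset L.Thr) : Run L Input Output P [] P
  | cons {P Q R : Multiset L.Thr} {a : Set S × Set S} {w : List (Set S × Set S)}
      (h : IOStep L Input Output P a Q) (hw : Run L Input Output Q w R) :
      Run L Input Output P (a :: w) R

/-- `tr(P)`: the words of the complete runs of `P`, that is of the infinite runs and of the finite
runs that cannot be extended. -/
def tr {S : Type} (L : Language S) (Input Output : Set S) (P : Multiset L.Thr) :
    Set (Word (Set S × Set S)) :=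
  {x | match x with
    | Word.finite w => ∃ Q, Run L Input Output P w Q ∧ ∀ a R, ¬ IOStep L Input Output Q a R
    | Word.infinite w => ∃ Q : ℕ → Multiset L.Thr,
        Q 0 = P ∧ ∀ n, IOStep L Input Output (Q n) (w n) (Q (n + 1))}

/-! ### The high level language -/

/-- Threads with free signal names in `V`, up to renaming of bound names: the body of `ν` is a
thread over `Option V`, in which `none` is the bound name. `Id n` is the type of thread identifiers
with `n` parameters. -/
inductive Thread (Id : ℕ → Type) : Type → Type 1
  | zero {V : Type} : Thread Id V
  | seq {V : Type} (T₁ T₂ : Thread Id V) : Thread Id V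
  | emit {V : Type} (s : V) : Thread Id V
  | nu {V : Type} (T : Thread Id (Option V)) : Thread Id V
  | spawn {V : Type} (T : Thread Id V) : Thread Id V
  | await {V : Type} (s : V) : Thread Id V
  | watch {V : Type} (s : V) (T : Thread Id V) : Thread Id V
  | call {V : Type} {n : ℕ} (A : Id n) (args : Fin n → V) : Thread Id V

namespace Thread

variable {Id : ℕ → Type}

/-- Substitution of signal names. -/
def map : {V W : Type} → (V → W) → Thread Id V → Thread Id W
  | _, _, _, zero => zero
  | _, _, f, seq T₁ T₂ => seq (map f T₁) (map f T₂)
  | _, _, f, emit s => emit (f s)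
  | _, _, f, nu T => nu (map (Option.map f) T)
  | _, _, f, spawn T => spawn (map f T)
  | _, _, f, await s => await (f s)
  | _, _, f, watch s T => watch (f s) (map f T)
  | _, _, f, call A args => call A (f ∘ args)

/-- The free signal names of a thread, listed with repetitions. -/
def names : {V : Type} → Thread Id V → List V
  | _, zero => []
  | _, seq T₁ T₂ => names T₁ ++ names T₂
  | _, emit s => [s]
  | _, nu T => (names T).reduceOption
  | _, spawn T => names T
  | _, await s => [s]
  | _, watch s T => s :: names T
  | _, call _ args => List.ofFn args

/-- Reduction of redexes. The equation of an identifier `A` with `n` parameters is `eqn n A`, a thread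
whose free names are the `n` parameters. In the rule for `ν` the bound name is renamed to any name
that is not in the domain of the environment. -/
inductive RedexStep {S : Type} (eqn : (n : ℕ) → Id n → Thread Id (Fin n)) :
    Thread Id S → Env S → Multiset (Thread Id S) → Thread Id S → Env S → Prop
  | zero_seq (T : Thread Id S) (E : Env S) : RedexStep eqn (seq zero T) E 0 T E
  | emit (s : S) (E : Env S) : RedexStep eqn (emit s) E 0 zero (E.set s true)
  | watch_zero (s : S) (E : Env S) : RedexStep eqn (watch s zero) E 0 zero E
  | nu (T : Thread Id (Option S)) (s : S) (E : Env S) (hs : E s = none) :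
      RedexStep eqn (nu T) E 0 (map (fun o => o.getD s) T) (E.set s false)
  | call {n : ℕ} (A : Id n) (args : Fin n → S) (E : Env S) :
      RedexStep eqn (call A args) E 0 (map args (eqn n A)) E
  | await (s : S) (E : Env S) (hs : E s = some true) : RedexStep eqn (await s) E 0 zero E
  | spawn (T : Thread Id S) (E : Env S) : RedexStep eqn (spawn T) E {T} zero E

/-- Evaluation contexts. Sequential composition is read up to associativity (it "associates to the
right"): on the syntax trees used here, where it may be nested to the left, this means that the
hole may stand under any number of left components of `;`. -/
inductive Ctx (Id : ℕ → Type) (S : Type) : Type 1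
  | hole : Ctx Id S
  | seq (C : Ctx Id S) (T : Thread Id S) : Ctx Id S
  | watch (s : S) (C : Ctx Id S) : Ctx Id S

/-- `C[T]`. -/
def Ctx.plug {S : Type} : Ctx Id S → Thread Id S → Thread Id S
  | .hole, T => T
  | .seq C U, T => Thread.seq (C.plug T) U
  | .watch s C, T => Thread.watch s (C.plug T)

/-- Reduction of threads. -/
inductive Step {S : Type} (eqn : (n : ℕ) → Id n → Thread Id (Fin n)) :
    Thread Id S → Env S → Multiset (Thread Id S) → Thread Id S → Env S → Prop
  | ctx (C : Ctx Id S) {D T' : Thread Id S} {E E' : Env S} {P : Multiset (Thread Id S)}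
      (h : RedexStep eqn D E P T' E') : Step eqn (C.plug D) E P (C.plug T') E'

/-- `⌊T⌋_E`. It is only meant for suspended threads; on all the other forms it is the identity. -/
def endInstant {S : Type} (E : Env S) : Thread Id S → Thread Id S
  | seq T T' => seq (endInstant E T) T'
  | watch s T => if E s = some true then zero else watch s (endInstant E T)
  | T => T

end Thread

/-- The high level language with the system of equations `eqn`. -/
abbrev highLevel {Id : ℕ → Type} (S : Type) (eqn : (n : ℕ) → Id n → Thread Id (Fin n)) :
    Language S where
  Thr := Thread Id S
  names := Thread.names
  step := Thread.Step eqn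
  endInstant := Thread.endInstant

/-! ### Tail recursive threads -/

mutual

/-- Tail recursive threads `t`, with the same conventions on names and identifiers as above. -/
inductive Tail (I : ℕ → Type 1) : Type → Type 1
  | zero {V : Type} : Tail I V
  | call {V : Type} {n : ℕ} (A : I n) (args : Fin n → V) : Tail I V
  | emit {V : Type} (s : V) (t : Tail I V) : Tail I V
  | nu {V : Type} (t : Tail I (Option V)) : Tail I V
  | spawn {V : Type} (t' t : Tail I V) : Tail I V
  | present {V : Type} (s : V) (t : Tail I V) (b : Branch I V) : Tail I V

/-- Branching threads `b`. -/
inductive Branch (I : ℕ → Type 1) : Type → Type 1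
  | ret {V : Type} (t : Tail I V) : Branch I V
  | ite {V : Type} (s : V) (b₁ b₂ : Branch I V) : Branch I V

/-- Sequences `τ = (s₁,t₁)⋯(sₙ,tₙ)`, extended on the right: `snoc τ s t` is `τ·(s,t)`. -/
inductive Handlers (I : ℕ → Type 1) : Type → Type 1
  | nil {V : Type} : Handlers I V
  | snoc {V : Type} (τ : Handlers I V) (s : V) (t : Tail I V) : Handlers I V

end

section TailRec

variable {I : ℕ → Type 1}

mutual

/-- Substitution of signal names. -/
def Tail.map : {V W : Type} → (V → W) → Tail I V → Tail I W
  | _, _, _, .zero => .zero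
  | _, _, f, .call A args => .call A (f ∘ args)
  | _, _, f, .emit s t => .emit (f s) (t.map f)
  | _, _, f, .nu t => .nu (t.map (Option.map f))
  | _, _, f, .spawn t' t => .spawn (t'.map f) (t.map f)
  | _, _, f, .present s t b => .present (f s) (t.map f) (b.map f)

/-- Substitution of signal names. -/
def Branch.map : {V W : Type} → (V → W) → Branch I V → Branch I W
  | _, _, f, .ret t => .ret (t.map f)
  | _, _, f, .ite s b₁ b₂ => .ite (f s) (b₁.map f) (b₂.map f)

end

/-- Substitution of signal names. -/
def Handlers.map {V W : Type} (f : V → W) : Handlers I V → Handlers I W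
  | .nil => .nil
  | .snoc τ s t => .snoc (τ.map f) (f s) (t.map f)

mutual

/-- The free signal names, listed with repetitions. -/
def Tail.names : {V : Type} → Tail I V → List V
  | _, .zero => []
  | _, .call _ args => List.ofFn args
  | _, .emit s t => s :: t.names
  | _, .nu t => t.names.reduceOption
  | _, .spawn t' t => t'.names ++ t.names
  | _, .present s t b => s :: (t.names ++ b.names)

/-- The free signal names, listed with repetitions. -/
def Branch.names : {V : Type} → Branch I V → List V
  | _, .ret t => t.names
  | _, .ite s b₁ b₂ => s :: (b₁.names ++ b₂.names)

end

/-- The free signal names, listed with repetitions. -/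
def Handlers.names {V : Type} : Handlers I V → List V
  | .nil => []
  | .snoc τ s t => τ.names ++ s :: t.names

/-- Extension of a substitution, defined on the free names of `ν t`, to the free names of `t`. -/
def liftSubst {V W : Type} (l : List (Option V)) (f : ∀ v, v ∈ l.reduceOption → W) :
    ∀ o, o ∈ l → Option W
  | none, _ => none
  | some v, h => some (f v (List.reduceOption_mem_iff.2 h))

mutual

/-- Substitution of signal names, where the substitution is only defined on the free names. -/
def Tail.pmap : {V W : Type} → (t : Tail I V) → (∀ v, v ∈ t.names → W) → Tail I W
  | _, _, .zero, _ => .zero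
  | _, _, .call A args, f => .call A fun i => f (args i) (by rw [Tail.names]; simp [List.mem_ofFn])
  | _, _, .emit s t, f =>
      .emit (f s (by rw [Tail.names]; simp)) (t.pmap fun v h => f v (by rw [Tail.names]; simp [h]))
  | _, _, .nu t, f =>
      .nu (t.pmap (liftSubst t.names fun v h => f v (by rw [Tail.names]; exact h)))
  | _, _, .spawn t' t, f =>
      .spawn (t'.pmap fun v h => f v (by rw [Tail.names]; simp [h]))
        (t.pmap fun v h => f v (by rw [Tail.names]; simp [h]))
  | _, _, .present s t b, f =>
      .present (f s (by rw [Tail.names]; simp)) (t.pmap fun v h => f v (by rw [Tail.names]; simp [h]))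
        (b.pmap fun v h => f v (by rw [Tail.names]; simp [h]))

/-- Substitution of signal names, where the substitution is only defined on the free names. -/
def Branch.pmap : {V W : Type} → (b : Branch I V) → (∀ v, v ∈ b.names → W) → Branch I W
  | _, _, .ret t, f => .ret (t.pmap fun v h => f v (by rw [Branch.names]; simp [h]))
  | _, _, .ite s b₁ b₂, f =>
      .ite (f s (by rw [Branch.names]; simp)) (b₁.pmap fun v h => f v (by rw [Branch.names]; simp [h]))
        (b₂.pmap fun v h => f v (by rw [Branch.names]; simp [h]))

end

/-- Substitution of signal names, where the substitution is only defined on the free names. -/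
def Handlers.pmap {V W : Type} : (τ : Handlers I V) → (∀ v, v ∈ τ.names → W) → Handlers I W
  | .nil, _ => .nil
  | .snoc τ s t, f =>
      .snoc (τ.pmap fun v h => f v (by rw [Handlers.names]; simp [h]))
        (f s (by rw [Handlers.names]; simp)) (t.pmap fun v h => f v (by rw [Handlers.names]; simp [h]))

/-- Reduction of tail recursive threads, for the system of equations `eqn`. -/
inductive Tail.Step {S : Type} (eqn : (n : ℕ) → I n → Tail I (Fin n)) :
    Tail I S → Env S → Multiset (Tail I S) → Tail I S → Env S → Prop
  | emit (s : S) (t : Tail I S) (E : Env S) : Step eqn (.emit s t) E 0 t (E.set s true)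
  | nu (t : Tail I (Option S)) (s : S) (E : Env S) (hs : E s = none) :
      Step eqn (.nu t) E 0 (t.map fun o => o.getD s) (E.set s false)
  | call {n : ℕ} (A : I n) (args : Fin n → S) (E : Env S) :
      Step eqn (.call A args) E 0 ((eqn n A).map args) E
  | present (s : S) (t : Tail I S) (b : Branch I S) (E : Env S) (hs : E s = some true) :
      Step eqn (.present s t b) E 0 t E
  | spawn (t' t : Tail I S) (E : Env S) : Step eqn (.spawn t' t) E {t'} t E

/-- Evaluation of a branching thread. -/
def Branch.eval {S : Type} (E : Env S) : Branch I S → Tail I S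
  | .ret t => t
  | .ite s b₁ b₂ => if E s = some true then b₁.eval E else b₂.eval E

/-- `⌊t⌋_E`. It is only meant for suspended threads; on all the other forms it is the identity. -/
def Tail.endInstant {S : Type} (E : Env S) : Tail I S → Tail I S
  | .present _ _ b => b.eval E
  | t => t

/-- The language of tail recursive threads with the system of equations `eqn`. -/
abbrev tailRec (S : Type) (eqn : (n : ℕ) → I n → Tail I (Fin n)) : Language S where
  Thr := Tail I S
  names := Tail.names
  step := Tail.Step eqn
  endInstant := Tail.endInstant

/-- `ite s₁ t₁ (⋯ (ite sₙ tₙ b) ⋯)` for `τ = (s₁,t₁)⋯(sₙ,tₙ)`. -/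
def Handlers.branch {V : Type} : Handlers I V → Branch I V → Branch I V
  | .nil, b => b
  | .snoc τ s t, b => τ.branch (.ite s (.ret t) b)

open Classical in
/-- The position of (the first occurrence of) a member of a list. -/
noncomputable def pos {V : Type} (l : List V) (v : V) (h : v ∈ l) : Fin l.length :=
  ⟨l.idxOf v, List.idxOf_lt_length_iff.2 h⟩

end TailRec

/-! ### The CPS translation -/

/-- The identifiers of the translated system of equations. The index `(t, τ)` is taken up to the
choice of its free names, which become parameters: it is a pair over the names `Fin m`.
`cps A t τ` is the identifier `A^(t,τ)`, whose parameters are those of `A` followed by the free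
names of `(t, τ)`. `await s t τ` is the identifier `A` of the equation
`A = present s t (ite s₁ t₁ (⋯ (ite sₙ tₙ A) ⋯))` used in the translation of `await s`; its
parameters are the free names of `s`, `t` and `τ`. -/
inductive CpsId (Id : ℕ → Type) : ℕ → Type 1
  | cps {k m : ℕ} (A : Id k) (t : Tail (CpsId Id) (Fin m)) (τ : Handlers (CpsId Id) (Fin m)) :
      CpsId Id (k + m)
  | await {m : ℕ} (s : Fin m) (t : Tail (CpsId Id) (Fin m)) (τ : Handlers (CpsId Id) (Fin m)) :
      CpsId Id m

section Cps

variable {Id : ℕ → Type}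

/-- The free names of `(t, τ)`, listed without repetitions. -/
noncomputable def contNames {V : Type} (t : Tail (CpsId Id) V) (τ : Handlers (CpsId Id) V) :
    List V :=
  open Classical in (t.names ++ τ.names).dedup

/-- The free names of `s`, `t` and `τ`, listed without repetitions. -/
noncomputable def awaitNames {V : Type} (s : V) (t : Tail (CpsId Id) V)
    (τ : Handlers (CpsId Id) V) : List V :=
  open Classical in (s :: (t.names ++ τ.names)).dedup

/-- `A^(t,τ)(args, s')`, where `s'` lists the free names of `(t, τ)`. -/
noncomputable def cpsCall {V : Type} {k : ℕ} (A : Id k) (args : Fin k → V)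
    (t : Tail (CpsId Id) V) (τ : Handlers (CpsId Id) V) : Tail (CpsId Id) V :=
  .call
    (.cps A (t.pmap fun v h => pos (contNames t τ) v (by rw [contNames]; simp [h]))
      (τ.pmap fun v h => pos (contNames t τ) v (by rw [contNames]; simp [h])))
    (Fin.append args (contNames t τ).get)

/-- The call of the identifier of the equation used in the translation of `await s`. -/
noncomputable def awaitCall {V : Type} (s : V) (t : Tail (CpsId Id) V)
    (τ : Handlers (CpsId Id) V) : Tail (CpsId Id) V :=
  .call
    (.await (pos (awaitNames s t τ) s (by rw [awaitNames]; simp))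
      (t.pmap fun v h => pos (awaitNames s t τ) v (by rw [awaitNames]; simp [h]))
      (τ.pmap fun v h => pos (awaitNames s t τ) v (by rw [awaitNames]; simp [h])))
    (awaitNames s t τ).get

/-- The CPS translation `⟦T⟧(t, τ)`. -/
noncomputable def cps : {V : Type} → Thread Id V → Tail (CpsId Id) V → Handlers (CpsId Id) V →
    Tail (CpsId Id) V
  | _, .zero, t, _ => t
  | _, .seq T₁ T₂, t, τ => cps T₁ (cps T₂ t τ) τ
  | _, .emit s, t, _ => .emit s t
  | _, .nu T, t, τ => .nu (cps T (t.map some) (τ.map some))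
  | _, .spawn T, t, _ => .spawn (cps T .zero .nil) t
  | _, .watch s T, t, τ => cps T t (.snoc τ s t)
  | _, .await s, t, τ => .present s t (τ.branch (.ret (awaitCall s t τ)))
  | _, .call A args, t, τ => cpsCall A args t τ

/-- The translated system of equations: `A^(t,τ)(x, s') = ⟦T⟧(t, τ)` where `A(x) = T`, and
`A = present s t (ite s₁ t₁ (⋯ (ite sₙ tₙ A) ⋯))` for the identifiers that come from `await`. -/
noncomputable def cpsEqn (eqn : (n : ℕ) → Id n → Thread Id (Fin n)) :
    (n : ℕ) → CpsId Id n → Tail (CpsId Id) (Fin n)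
  | _, .cps (k := k) (m := m) A t τ =>
      cps ((eqn k A).map (Fin.castAdd m)) (t.map (Fin.natAdd k)) (τ.map (Fin.natAdd k))
  | _, .await s t τ => .present s t (τ.branch (.ret (.call (.await s t τ) id)))

/-- `⟦P⟧`. -/
noncomputable def cpsProg {S : Type} (P : Multiset (Thread Id S)) :
    Multiset (Tail (CpsId Id) S) :=
  P.map fun T => cps T .zero .nil

end Cps

end SL

/-!
The proof exhibits a weak bisimulation between a program and its translation. The state of a
source thread under evaluation is the redex together with the stack of the continuations `[ ]; T`
and of the `watch s [ ]` around it. A tail recursive thread `⟦T⟧(t, τ)` represents this stack: `t`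
represents the part of the stack that is left once the redex is done, and each handler in `τ`
represents the part outside one of the `watch`es, so that evaluating the nested `ite`s at the end
of an instant does what `⌊ ⌋_E` does to the `watch`es of the source thread.

The two sides do not move in lockstep. The steps that remove a completed `0; [ ]` or `watch s 0`
have no counterpart in the translation, but there are finitely many of them before the next
instruction; conversely, unfolding the identifier of the equation of an `await` has no counterpart
in the source. The names generated by `ν` may differ, so the bisimulation carries a bijective
correspondence between the names of the two programs, which is the identity on `Int`; there are
always fresh names since the complement of `Int` is infinite and a program has finitely many free
names.
-/

namespace SL

/-! ### Simulations and traces -/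

section Traces

variable {S : Type} {L L' : Language S} {Input Output : Set S}
  {R : Multiset L.Thr → Multiset L'.Thr → Prop}

/-- `R` is a simulation of the programs of `L` by those of `L'`, for the transitions of a whole
instant. -/
def IsSimulation (L L' : Language S) (Input Output : Set S)
    (R : Multiset L.Thr → Multiset L'.Thr → Prop) : Prop :=
  ∀ ⦃P Q a P'⦄, R P Q → IOStep L Input Output P a P' →
    ∃ Q', IOStep L' Input Output Q a Q' ∧ R P' Q'

theorem IsSimulation.run (hsim : IsSimulation L L' Input Output R)
    {P P' : Multiset L.Thr} {w : List (Set S × Set S)} (hrun : Run L Input Output P w P') :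
    ∀ {Q}, R P Q → ∃ Q', Run L' Input Output Q w Q' ∧ R P' Q' := by
  induction hrun with
  | nil P => exact fun {Q} hPQ => ⟨Q, .nil Q, hPQ⟩
  | cons hstep _ ih =>
    intro Q hPQ
    obtain ⟨Q₁, hstep', hPQ₁⟩ := hsim hPQ hstep
    obtain ⟨Q', hrun', hPQ'⟩ := ih hPQ₁
    exact ⟨Q', .cons hstep' hrun', hPQ'⟩

theorem IsSimulation.infinite_run (hsim : IsSimulation L L' Input Output R)
    {P : ℕ → Multiset L.Thr} {w : ℕ → Set S × Set S}
    (hP : ∀ n, IOStep L Input Output (P n) (w n) (P (n + 1)))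
    {Q₀ : Multiset L'.Thr} (h₀ : R (P 0) Q₀) :
    ∃ Q : ℕ → Multiset L'.Thr,
      Q 0 = Q₀ ∧ ∀ n, IOStep L' Input Output (Q n) (w n) (Q (n + 1)) := by
  choose! next hnext using fun (n : ℕ) (Q : Multiset L'.Thr) (h : R (P n) Q) => hsim h (hP n)
  let Q : ℕ → Multiset L'.Thr := fun n => Nat.rec Q₀ next n
  have hR : ∀ n, R (P n) (Q n) := fun n => Nat.rec h₀ (fun n ih => (hnext n _ ih).2) n
  exact ⟨Q, rfl, fun n => (hnext n _ (hR n)).1⟩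

-- Transferring the maximality of a finite run takes the simulation in the other direction.
theorem IsSimulation.tr_subset (hsim : IsSimulation L L' Input Output R)
    (hsim' : IsSimulation L' L Input Output (flip R))
    {P : Multiset L.Thr} {Q : Multiset L'.Thr} (hPQ : R P Q) :
    tr L Input Output P ⊆ tr L' Input Output Q := by
  rintro (w | w) hw
  · obtain ⟨P', hrun, hmax⟩ := hw
    obtain ⟨Q', hrun', hPQ'⟩ := hsim.run hrun hPQ
    refine ⟨Q', hrun', fun a Q'' hstep => ?_⟩
    obtain ⟨P'', hstep', -⟩ := hsim' hPQ' hstep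
    exact hmax a P'' hstep'
  · obtain ⟨X, rfl, hX⟩ := hw
    exact hsim.infinite_run hX hPQ

theorem IsSimulation.tr_eq (hsim : IsSimulation L L' Input Output R)
    (hsim' : IsSimulation L' L Input Output (flip R))
    {P : Multiset L.Thr} {Q : Multiset L'.Thr} (hPQ : R P Q) :
    tr L Input Output P = tr L' Input Output Q :=
  (hsim.tr_subset hsim' hPQ).antisymm (hsim'.tr_subset hsim hPQ)

end Traces

/-! ### From threads to programs -/

section Programs

variable {S : Type} {L L' : Language S}

/-- `T` cannot be reduced in `E`. -/
def Irreducible (L : Language S) (E : Env S) (T : L.Thr) : Prop :=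
  ∀ P T' E', ¬ L.step T E P T' E'

/-- `T` reduces to `T'` in any number of steps as a member of a program, spawning `P`. -/
def ThreadSteps (L : Language S) (T : L.Thr) (E : Env S) (P : Multiset L.Thr) (T' : L.Thr)
    (E' : Env S) : Prop :=
  ∀ R : Multiset L.Thr, Relation.ReflTransGen (ProgStep L) (R + {T}, E) (R + {T'} + P, E')

theorem ThreadSteps.refl {T : L.Thr} {E : Env S} : ThreadSteps L T E 0 T E := by
  intro R
  rw [add_zero]

theorem ThreadSteps.single {T T' : L.Thr} {E E' : Env S} {P : Multiset L.Thr}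
    (h : L.step T E P T' E') : ThreadSteps L T E P T' E' :=
  fun _ => .single (ProgStep.mk h)

theorem ThreadSteps.trans {T T' T'' : L.Thr} {E E' E'' : Env S} {P : Multiset L.Thr}
    (h : ThreadSteps L T E 0 T' E') (h' : ThreadSteps L T' E' P T'' E'') :
    ThreadSteps L T E P T'' E'' := by
  intro R
  refine (h R).trans ?_
  rw [add_zero]
  exact h' R

/-- A simulation of the threads of `L` by those of `L'`. The relation `R ω` between threads and the
relation `Γ ω` between environments depend on a world `ω`, which may grow along the reductions; it
stands for what is known about the signal names generated so far. -/
structure IsThreadSimulation {Ω : Type*} [Preorder Ω] (L L' : Language S)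
    (Γ : Ω → Env S → Env S → Prop) (R : Ω → L.Thr → L'.Thr → Prop) : Prop where
  mono {ω ω' : Ω} {T : L.Thr} {u : L'.Thr} : ω ≤ ω' → R ω T u → R ω' T u
  step {ω : Ω} {T T' : L.Thr} {u : L'.Thr} {E E' F : Env S} {P : Multiset L.Thr} :
    Γ ω E F → R ω T u → L.step T E P T' E' →
      ∃ Q u' F', ThreadSteps L' u F Q u' F' ∧
        ∃ ω' ≥ ω, Γ ω' E' F' ∧ R ω' T' u' ∧ Multiset.Rel (R ω') P Q
  settle {ω : Ω} {T : L.Thr} {u : L'.Thr} {E F : Env S} :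
    Γ ω E F → R ω T u → Irreducible L E T →
      ∃ u', ThreadSteps L' u F 0 u' F ∧ Irreducible L' F u' ∧
        R ω (L.endInstant E T) (L'.endInstant F u')

namespace IsThreadSimulation

variable {Ω : Type*} [Preorder Ω] {Γ : Ω → Env S → Env S → Prop} {R : Ω → L.Thr → L'.Thr → Prop}

theorem progStep (hsim : IsThreadSimulation L L' Γ R) {P P' : Multiset L.Thr}
    {Q : Multiset L'.Thr} {E E' F : Env S} {ω : Ω} (hE : Γ ω E F) (hPQ : Multiset.Rel (R ω) P Q)
    (hstep : ProgStep L (P, E) (P', E')) :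
    ∃ Q' F' ω', Relation.ReflTransGen (ProgStep L') (Q, F) (Q', F') ∧
      Γ ω' E' F' ∧ Multiset.Rel (R ω') P' Q' := by
  obtain @⟨P, T, T', _, _, P'', hstep⟩ := hstep
  rw [add_comm, Multiset.singleton_add, Multiset.rel_cons_left] at hPQ
  obtain ⟨u, Q, hTu, hPQ, rfl⟩ := hPQ
  obtain ⟨Q'', u', F', hsteps, ω', hω, hE', hTu', hPQ'⟩ := hsim.step hE hTu hstep
  have hframe := hsteps Q
  rw [add_comm Q, Multiset.singleton_add] at hframe
  refine ⟨_, F', ω', hframe, hE', .add (.add ?_ ?_) hPQ'⟩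
  · exact hPQ.mono fun _ _ _ _ => hsim.mono hω
  · exact .cons hTu' .zero

theorem progSteps (hsim : IsThreadSimulation L L' Γ R) {Q : Multiset L'.Thr} {F : Env S} {ω : Ω}
    {p p' : Multiset L.Thr × Env S} (hE : Γ ω p.2 F) (hPQ : Multiset.Rel (R ω) p.1 Q)
    (hsteps : Relation.ReflTransGen (ProgStep L) p p') :
    ∃ Q' F' ω', Relation.ReflTransGen (ProgStep L') (Q, F) (Q', F') ∧
      Γ ω' p'.2 F' ∧ Multiset.Rel (R ω') p'.1 Q' := by
  induction hsteps with
  | refl => exact ⟨Q, F, ω, .refl, hE, hPQ⟩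
  | tail _ hstep ih =>
    obtain ⟨Q₁, F₁, ω₁, hsteps₁, hE₁, hPQ₁⟩ := ih
    obtain ⟨Q₂, F₂, ω₂, hsteps₂, h₂⟩ := hsim.progStep hE₁ hPQ₁ hstep
    exact ⟨Q₂, F₂, ω₂, hsteps₁.trans hsteps₂, h₂⟩

theorem settle_prog (hsim : IsThreadSimulation L L' Γ R) {P : Multiset L.Thr}
    {Q : Multiset L'.Thr} {E F : Env S} {ω : Ω} (hE : Γ ω E F) (hPQ : Multiset.Rel (R ω) P Q)
    (hP : Suspended L P E) :
    ∃ Q', Relation.ReflTransGen (ProgStep L') (Q, F) (Q', F) ∧ Suspended L' Q' F ∧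
      Multiset.Rel (R ω) (P.map (L.endInstant E)) (Q'.map (L'.endInstant F)) := by
  suffices ∃ Q', (∀ X, Relation.ReflTransGen (ProgStep L') (X + Q, F) (X + Q', F)) ∧
      Suspended L' Q' F ∧
      Multiset.Rel (R ω) (P.map (L.endInstant E)) (Q'.map (L'.endInstant F)) by
    obtain ⟨Q', hsteps, h⟩ := this
    exact ⟨Q', by simpa only [zero_add] using hsteps 0, h⟩
  induction hPQ with
  | zero => exact ⟨0, fun _ => .refl, by simp [Suspended], .zero⟩
  | @cons T u P Q hTu _ ih =>
    obtain ⟨hT, hP⟩ := Multiset.forall_mem_cons.1 hP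
    obtain ⟨Q', hQ, hQ', hrel⟩ := ih hP
    obtain ⟨u', hu, hu', hTu'⟩ := hsim.settle hE hTu hT
    refine ⟨u' ::ₘ Q', fun X => ?_, Multiset.forall_mem_cons.2 ⟨hu', hQ'⟩, ?_⟩
    · have hQ := hQ (X + {u})
      have hu := hu (X + Q')
      rw [add_right_comm X Q' {u}, add_right_comm X Q' {u'}, add_zero] at hu
      simpa only [← Multiset.singleton_add, ← add_assoc] using hQ.trans hu
    · simpa only [Multiset.map_cons] using hrel.cons hTu'

theorem isSimulation (hsim : IsThreadSimulation L L' Γ R) {Input Output : Set S}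
    {N : Multiset L.Thr → Multiset L'.Thr → Prop}
    (hstart : ∀ {P Q I}, N P Q → I ⊆ Input → ∃ ω,
      Γ ω (initEnv L Input Output I P) (initEnv L' Input Output I Q) ∧ Multiset.Rel (R ω) P Q)
    (houtput : ∀ {ω E F s}, Γ ω E F → s ∈ Output → E s = F s)
    (hfinish : ∀ {ω E F P Q}, Γ ω E F → Multiset.Rel (R ω) P Q → N P Q) :
    IsSimulation L L' Input Output N := by
  rintro P Q ⟨I, O⟩ _ hPQ ⟨hI, P₁, E, hsteps, hsusp, hO, rfl⟩
  obtain ⟨ω₀, hE₀, hPQ₀⟩ := hstart hPQ hI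
  obtain ⟨Q₁, F, ω, hsteps₁, hE, hPQ₁⟩ := hsim.progSteps hE₀ hPQ₀ hsteps
  obtain ⟨Q₂, hsteps₂, hsusp', hPQ₂⟩ := hsim.settle_prog hE hPQ₁ hsusp
  replace hE : Γ ω E F := hE
  have hO' : O = {s | s ∈ Output ∧ F s = some true} :=
    hO.trans (Set.ext fun s => and_congr_right fun hs => by rw [houtput hE hs])
  exact ⟨_, ⟨hI, Q₂, F, hsteps₁.trans hsteps₂, hsusp', hO', rfl⟩, hfinish hE hPQ₂⟩

end IsThreadSimulation

end Programs

/-! ### Substitution of signal names -/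

section Substitution

variable {Id : ℕ → Type}

theorem Thread.map_map : ∀ {U V W : Type} (f : V → W) (g : U → V) (T : Thread Id U),
    (T.map g).map f = T.map (f ∘ g)
  | _, _, _, _, _, .zero => rfl
  | _, _, _, f, g, .seq T₁ T₂ => by simp only [Thread.map, Thread.map_map f g]
  | _, _, _, _, _, .emit _ => rfl
  | _, _, _, f, g, .nu T => by
      simp only [Thread.map, Thread.map_map (Option.map f) (Option.map g), Option.map_comp_map]
  | _, _, _, f, g, .spawn T => by simp only [Thread.map, Thread.map_map f g]
  | _, _, _, _, _, .await _ => rfl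
  | _, _, _, f, g, .watch s T => by simp only [Thread.map, Thread.map_map f g, Function.comp]
  | _, _, _, _, _, .call _ _ => rfl

theorem Thread.map_id : ∀ {V : Type} (T : Thread Id V), T.map id = T
  | _, .zero => rfl
  | _, .seq T₁ T₂ => by simp only [Thread.map, Thread.map_id]
  | _, .emit _ => rfl
  | _, .nu T => by simp only [Thread.map, Option.map_id, Thread.map_id]
  | _, .spawn T => by simp only [Thread.map, Thread.map_id]
  | _, .await _ => rfl
  | _, .watch s T => by simp only [Thread.map, Thread.map_id, id]
  | _, .call _ _ => rfl

theorem reduceOption_map_map {V W : Type} (f : V → W) (l : List (Option V)) :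
    (l.map (Option.map f)).reduceOption = l.reduceOption.map f := by
  induction l with
  | nil => rfl
  | cons o l ih => cases o <;> simp [ih]

theorem Thread.names_map : ∀ {V W : Type} (f : V → W) (T : Thread Id V),
    (T.map f).names = T.names.map f
  | _, _, _, .zero => rfl
  | _, _, f, .seq T₁ T₂ => by
      simp only [Thread.map, Thread.names, Thread.names_map f, List.map_append]
  | _, _, _, .emit _ => rfl
  | _, _, f, .nu T => by
      simp only [Thread.map, Thread.names, Thread.names_map, reduceOption_map_map]
  | _, _, f, .spawn T => by simp only [Thread.map, Thread.names, Thread.names_map f]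
  | _, _, _, .await _ => rfl
  | _, _, f, .watch s T => by
      simp only [Thread.map, Thread.names, Thread.names_map f, List.map_cons]
  | _, _, f, .call _ args => by simp only [Thread.map, Thread.names, List.map_ofFn]

variable {I : ℕ → Type 1}

theorem Handlers.mem_names_branch {V : Type} {v : V} {τ : Handlers I V} {b : Branch I V} :
    v ∈ (τ.branch b).names ↔ v ∈ τ.names ∨ v ∈ b.names := by
  induction τ using Handlers.rec (motive_1 := fun _ _ => True) (motive_2 := fun _ _ => True) with
  | nil => simp only [Handlers.branch, Handlers.names, List.not_mem_nil, false_or]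
  | snoc τ s t ih =>
    rw [Handlers.branch, ih]
    simp only [Branch.names, Handlers.names, List.mem_append, List.mem_cons]
    tauto
  | _ => trivial

mutual

theorem Tail.pmap_eq_map : ∀ {V W : Type} (t : Tail I V) (f : V → W),
    (t.pmap fun v _ => f v) = t.map f
  | _, _, .zero, _ => by rw [Tail.pmap, Tail.map]
  | _, _, .call _ _, _ => by rw [Tail.pmap, Tail.map]; rfl
  | _, _, .emit _ t, f => by rw [Tail.pmap, Tail.map, t.pmap_eq_map f]
  | _, _, .nu t, f => by
      have hlift : (liftSubst t.names fun v _ => f v) = fun o _ => Option.map f o :=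
        funext fun o => by cases o <;> rfl
      rw [Tail.pmap, Tail.map, hlift, t.pmap_eq_map (Option.map f)]
  | _, _, .spawn t' t, f => by rw [Tail.pmap, Tail.map, t'.pmap_eq_map f, t.pmap_eq_map f]
  | _, _, .present _ t b, f => by rw [Tail.pmap, Tail.map, t.pmap_eq_map f, b.pmap_eq_map f]

theorem Branch.pmap_eq_map : ∀ {V W : Type} (b : Branch I V) (f : V → W),
    (b.pmap fun v _ => f v) = b.map f
  | _, _, .ret t, f => by rw [Branch.pmap, Branch.map, t.pmap_eq_map f]
  | _, _, .ite _ b₁ b₂, f => by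
      rw [Branch.pmap, Branch.map, b₁.pmap_eq_map f, b₂.pmap_eq_map f]

end

theorem Handlers.pmap_eq_map {V W : Type} (f : V → W) :
    ∀ τ : Handlers I V, (τ.pmap fun v _ => f v) = τ.map f
  | .nil => by rw [Handlers.pmap, Handlers.map]
  | .snoc τ _ t => by rw [Handlers.pmap, Handlers.map, τ.pmap_eq_map f, t.pmap_eq_map f]

theorem Handlers.pmap_branch {V W : Type} :
    ∀ (τ : Handlers I V) (b : Branch I V) (f : ∀ v, v ∈ (τ.branch b).names → W),
      (τ.branch b).pmap f =
        (τ.pmap fun v h => f v (mem_names_branch.2 (.inl h))).branch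
          (b.pmap fun v h => f v (mem_names_branch.2 (.inr h)))
  | .nil, _, _ => rfl
  | .snoc τ s t, b, f => by
      simp only [Handlers.branch, Handlers.pmap, Branch.pmap, τ.pmap_branch (.ite s (.ret t) b) f]

theorem get_pos {V : Type} (l : List V) (v : V) (h : v ∈ l) : l.get (pos l v h) = v := by
  classical
  simp only [pos, List.get_eq_getElem]
  convert List.getElem_idxOf (List.idxOf_lt_length_iff.2 h)

end Substitution

/-! ### Stacks -/

section Stacks

variable {Id : ℕ → Type}

/-- What remains to be done by a thread, innermost first: `inl T` stands for the continuation
`[ ]; T` and `inr s` for the enclosing `watch s [ ]`. -/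
abbrev Stack (Id : ℕ → Type) (V : Type) : Type 1 := List (Thread Id V ⊕ V)

/-- Substitution of signal names. -/
def Stack.map {V W : Type} (f : V → W) (K : Stack Id V) : Stack Id W :=
  List.map (Sum.map (Thread.map f) f) K

theorem Stack.map_cons {V W : Type} (f : V → W) (T : Thread Id V) (K : Stack Id V) :
    Stack.map f (.inl T :: K) = .inl (T.map f) :: Stack.map f K := rfl

/-- The free signal names of a stack. -/
def Stack.names {V : Type} : Stack Id V → List V
  | [] => []
  | .inl T :: K => T.names ++ Stack.names K
  | .inr s :: K => s :: Stack.names K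

theorem Stack.map_map {U V W : Type} (f : V → W) (g : U → V) (K : Stack Id U) :
    (K.map g).map f = K.map (f ∘ g) := by
  simp only [Stack.map, List.map_map]
  congr 1
  funext x
  cases x <;> simp [Thread.map_map]

theorem Stack.map_id {V : Type} (K : Stack Id V) : K.map id = K := by
  simp only [Stack.map]
  convert List.map_id K
  funext x
  cases x <;> simp [Thread.map_id]

theorem Stack.names_map {V W : Type} (f : V → W) :
    ∀ K : Stack Id V, (K.map f).names = K.names.map f
  | [] => rfl
  | .inl T :: K => by
      change (T.map f).names ++ (Stack.map f K).names = (T.names ++ Stack.names K).map f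
      rw [Thread.names_map, Stack.names_map f K, List.map_append]
  | .inr s :: K => congrArg (f s :: ·) (Stack.names_map f K)

variable {V : Type}

/-- The thread `T` in the evaluation context given by the stack. -/
def Stack.plug : Stack Id V → Thread Id V → Thread Id V
  | [], T => T
  | .inl U :: K, T => Stack.plug K (.seq T U)
  | .inr s :: K, T => Stack.plug K (.watch s T)

/-- The thread that executes a stack. -/
def Stack.thread : Stack Id V → Thread Id V
  | [] => .zero
  | .inl T :: K => Stack.plug K T
  | .inr s :: K => Stack.plug K (.watch s .zero)

/-- The stack of an evaluation context, on top of the stack `K`. Contexts are built from the outside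
and stacks from the inside. -/
def Thread.Ctx.stack : Thread.Ctx Id V → Stack Id V → Stack Id V
  | .hole, K => K
  | .seq C U, K => C.stack (.inl U :: K)
  | .watch s C, K => C.stack (.inr s :: K)

end Stacks

/-! ### Translations of stacks -/

section Representation

variable {Id : ℕ → Type}

mutual

/-- `Represents ρ K u`: the tail recursive thread `u` is a CPS translation of the stack `K`, where
the names of `K` correspond to those of `u` through the relation `ρ`. The indices `(t, τ)` of the
identifiers in `u` need not be the ones chosen by `cps`: only the instances of `t` and `τ` under the
arguments of the call matter. -/
inductive Represents :
    {V W : Type} → (V → W → Prop) → Stack Id V → Tail (CpsId Id) W → Prop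
  | nil {V W : Type} {ρ : V → W → Prop} : Represents ρ [] .zero
  | zero {V W : Type} {ρ : V → W → Prop} {K : Stack Id V} {u : Tail (CpsId Id) W}
      (h : Represents ρ K u) : Represents ρ (.inl .zero :: K) u
  | seq {V W : Type} {ρ : V → W → Prop} {K : Stack Id V} {T₁ T₂ : Thread Id V}
      {u : Tail (CpsId Id) W} (h : Represents ρ (.inl T₁ :: .inl T₂ :: K) u) :
      Represents ρ (.inl (.seq T₁ T₂) :: K) u
  | watch {V W : Type} {ρ : V → W → Prop} {K : Stack Id V} {v : V} {T : Thread Id V}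
      {u : Tail (CpsId Id) W} (h : Represents ρ (.inl T :: .inr v :: K) u) :
      Represents ρ (.inl (.watch v T) :: K) u
  | leave {V W : Type} {ρ : V → W → Prop} {K : Stack Id V} {v : V} {u : Tail (CpsId Id) W}
      (h : Represents ρ K u) : Represents ρ (.inr v :: K) u
  | emit {V W : Type} {ρ : V → W → Prop} {K : Stack Id V} {v : V} {w : W}
      {u : Tail (CpsId Id) W} (hs : ρ v w) (h : Represents ρ K u) :
      Represents ρ (.inl (.emit v) :: K) (.emit w u)
  | nu {V W : Type} {ρ : V → W → Prop} {K : Stack Id V} {T : Thread Id (Option V)}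
      {u : Tail (CpsId Id) (Option W)}
      (h : Represents (Option.Rel ρ) (.inl T :: K.map some) u) :
      Represents ρ (.inl (.nu T) :: K) (.nu u)
  | spawn {V W : Type} {ρ : V → W → Prop} {K : Stack Id V} {T : Thread Id V}
      {u' u : Tail (CpsId Id) W} (h' : Represents ρ [.inl T] u') (h : Represents ρ K u) :
      Represents ρ (.inl (.spawn T) :: K) (.spawn u' u)
  | present {V W : Type} {ρ : V → W → Prop} {K : Stack Id V} {v : V} {w : W}
      {u u' : Tail (CpsId Id) W} {τ : Handlers (CpsId Id) W} (hs : ρ v w)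
      (h : Represents ρ K u) (hτ : RepresentsHandlers ρ K τ)
      (h' : Represents ρ (.inl (.await v) :: K) u') :
      Represents ρ (.inl (.await v) :: K) (.present w u (τ.branch (.ret u')))
  | awaitCall {V W : Type} {ρ : V → W → Prop} {K : Stack Id V} {v : V} {m : ℕ} {s : Fin m}
      {t : Tail (CpsId Id) (Fin m)} {τ : Handlers (CpsId Id) (Fin m)} {args : Fin m → W}
      (hs : ρ v (args s)) (h : Represents (fun v i => ρ v (args i)) K t)
      (hτ : RepresentsHandlers (fun v i => ρ v (args i)) K τ) :
      Represents ρ (.inl (.await v) :: K) (.call (.await s t τ) args)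
  | cpsCall {V W : Type} {ρ : V → W → Prop} {K : Stack Id V} {k m : ℕ} {A : Id k}
      {a : Fin k → V} {t : Tail (CpsId Id) (Fin m)} {τ : Handlers (CpsId Id) (Fin m)}
      {args : Fin (k + m) → W} (ha : ∀ i, ρ (a i) (args (Fin.castAdd m i)))
      (h : Represents (fun v i => ρ v (args (Fin.natAdd k i))) K t)
      (hτ : RepresentsHandlers (fun v i => ρ v (args (Fin.natAdd k i))) K τ) :
      Represents ρ (.inl (.call A a) :: K) (.call (.cps A t τ) args)

/-- `RepresentsHandlers ρ K τ`: the sequence `τ` lists the enclosing `watch`es of the stack `K`,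
together with CPS translations of the stacks they lead to. -/
inductive RepresentsHandlers :
    {V W : Type} → (V → W → Prop) → Stack Id V → Handlers (CpsId Id) W → Prop
  | nil {V W : Type} {ρ : V → W → Prop} : RepresentsHandlers ρ [] .nil
  | skip {V W : Type} {ρ : V → W → Prop} {K : Stack Id V} {T : Thread Id V}
      {τ : Handlers (CpsId Id) W} (h : RepresentsHandlers ρ K τ) :
      RepresentsHandlers ρ (.inl T :: K) τ
  | snoc {V W : Type} {ρ : V → W → Prop} {K : Stack Id V} {v : V} {w : W}
      {τ : Handlers (CpsId Id) W} {t : Tail (CpsId Id) W} (hs : ρ v w)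
      (h : RepresentsHandlers ρ K τ) (ht : Represents ρ K t) :
      RepresentsHandlers ρ (.inr v :: K) (.snoc τ w t)

end

theorem Stack.map_option_map {V W : Type} (f : V → W) (K : Stack Id V) :
    (K.map some).map (Option.map f) = (K.map f).map some := by
  rw [Stack.map_map, Stack.map_map]
  rfl

mutual

theorem Represents.map_left : ∀ {V V' W : Type} {ρ : V → W → Prop} {ρ' : V' → W → Prop}
    (f : V → V') {K : Stack Id V} {u : Tail (CpsId Id) W},
    (∀ v ∈ K.names, ∀ w ∈ u.names, ρ v w → ρ' (f v) w) → Represents ρ K u →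
      Represents ρ' (K.map f) u
  | _, _, _, _, _, _, _, _, _, .nil => .nil
  | _, _, _, _, _, f, _, _, H, .zero h => .zero (h.map_left f H)
  | _, _, _, _, _, f, _, _, H, .seq h =>
      .seq (h.map_left f fun v hv => H v (by simpa [Stack.names, Thread.names] using hv))
  | _, _, _, _, _, f, _, _, H, .watch h =>
      .watch (h.map_left f fun v hv => H v (by
        simpa [Stack.names, Thread.names, or_left_comm] using hv))
  | _, _, _, _, _, f, _, _, H, .leave h =>
      .leave (h.map_left f fun v hv => H v (by simp [Stack.names, hv]))
  | _, _, _, _, _, f, _, _, H, .emit hs h => by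
      simp only [Stack.names, Thread.names, Tail.names, List.mem_append, List.mem_cons] at H
      exact .emit (H _ (by simp) _ (by simp) hs)
        (h.map_left f fun v hv w hw => H v (by simp [hv]) w (by simp [hw]))
  | _, _, _, _, ρ', f, .inl (.nu T) :: K, .nu u, H, .nu h => by
      simp only [Stack.names, Thread.names, Tail.names, List.mem_append,
        List.reduceOption_mem_iff] at H
      rw [Stack.map_cons]
      refine .nu ?_
      rw [← Stack.map_option_map, ← Stack.map_cons]
      refine h.map_left (Option.map f) ?_
      rintro _ hv _ hw (hvw | _)
      · refine .some (H _ ?_ _ hw hvw)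
        simpa [Stack.names, Stack.names_map some] using hv
      · exact .none
  | _, _, _, _, _, f, _, _, H, .spawn h' h => by
      simp only [Stack.names, Thread.names, Tail.names, List.mem_append] at H
      exact .spawn (h'.map_left f fun v hv w hw =>
          H v (.inl (by simpa only [Stack.names, List.append_nil] using hv)) w (.inl hw))
        (h.map_left f fun v hv w hw => H v (.inr hv) w (.inr hw))
  | _, _, _, _, _, f, _, _, H, .present hs h hτ h' => by
      simp only [Stack.names, Thread.names, Tail.names, Branch.names, Handlers.mem_names_branch,
        List.mem_append, List.mem_cons] at H
      refine .present (H _ (by simp) _ (by simp) hs) (h.map_left f ?_) (hτ.map_left f ?_)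
        (h'.map_left f ?_)
      · exact fun v hv w hw => H v (by simp [hv]) w (by simp [hw])
      · exact fun v hv w hw => H v (by simp [hv]) w (by simp [hw])
      · exact fun v hv w hw => H v (by simpa [Stack.names, Thread.names] using hv) w (by simp [hw])
  | _, _, _, _, _, f, _, _, H, .awaitCall hs h hτ => by
      simp only [Stack.names, Thread.names, Tail.names, List.mem_append, List.mem_ofFn] at H
      exact .awaitCall (H _ (by simp) _ ⟨_, rfl⟩ hs)
        (h.map_left f fun v hv i _ => H v (.inr hv) _ ⟨i, rfl⟩)
        (hτ.map_left f fun v hv i _ => H v (.inr hv) _ ⟨i, rfl⟩)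
  | _, _, _, _, _, f, _, _, H, .cpsCall ha h hτ => by
      simp only [Stack.names, Thread.names, Tail.names, List.mem_append, List.mem_ofFn] at H
      exact .cpsCall (fun i => H _ (.inl ⟨i, rfl⟩) _ ⟨_, rfl⟩ (ha i))
        (h.map_left f fun v hv i _ => H v (.inr hv) _ ⟨_, rfl⟩)
        (hτ.map_left f fun v hv i _ => H v (.inr hv) _ ⟨_, rfl⟩)

theorem RepresentsHandlers.map_left : ∀ {V V' W : Type} {ρ : V → W → Prop} {ρ' : V' → W → Prop}
    (f : V → V') {K : Stack Id V} {τ : Handlers (CpsId Id) W},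
    (∀ v ∈ K.names, ∀ w ∈ τ.names, ρ v w → ρ' (f v) w) → RepresentsHandlers ρ K τ →
      RepresentsHandlers ρ' (K.map f) τ
  | _, _, _, _, _, _, _, _, _, .nil => .nil
  | _, _, _, _, _, f, _, _, H, .skip h =>
      .skip (h.map_left f fun v hv => H v (by simp [Stack.names, hv]))
  | _, _, _, _, _, f, _, _, H, .snoc hs h ht => by
      simp only [Stack.names, Handlers.names, List.mem_append, List.mem_cons] at H
      exact .snoc (H _ (by simp) _ (by simp) hs)
        (h.map_left f fun v hv w hw => H v (.inr hv) w (.inl hw))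
        (ht.map_left f fun v hv w hw => H v (.inr hv) w (.inr (.inr hw)))

end

theorem Represents.mono {V W : Type} {ρ ρ' : V → W → Prop} {K : Stack Id V}
    {u : Tail (CpsId Id) W} (hρ : ∀ v w, ρ v w → ρ' v w) (h : Represents ρ K u) :
    Represents ρ' K u :=
  K.map_id ▸ h.map_left id fun v _ w _ => hρ v w

theorem RepresentsHandlers.mono {V W : Type} {ρ ρ' : V → W → Prop} {K : Stack Id V}
    {τ : Handlers (CpsId Id) W} (hρ : ∀ v w, ρ v w → ρ' v w) (h : RepresentsHandlers ρ K τ) :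
    RepresentsHandlers ρ' K τ :=
  K.map_id ▸ h.map_left id fun v _ w _ => hρ v w

mutual

theorem Represents.pmap : ∀ {V W W' : Type} {ρ : V → W → Prop} {ρ' : V → W' → Prop}
    {K : Stack Id V} {u : Tail (CpsId Id) W} (f : ∀ w, w ∈ u.names → W'),
    (∀ v w hw, ρ v w → ρ' v (f w hw)) → Represents ρ K u → Represents ρ' K (u.pmap f)
  | _, _, _, _, _, _, _, _, _, .nil => by rw [Tail.pmap]; exact .nil
  | _, _, _, _, _, _, _, f, H, .zero h => .zero (h.pmap f H)
  | _, _, _, _, _, _, _, f, H, .seq h => .seq (h.pmap f H)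
  | _, _, _, _, _, _, _, f, H, .watch h => .watch (h.pmap f H)
  | _, _, _, _, _, _, _, f, H, .leave h => .leave (h.pmap f H)
  | _, _, _, _, _, _, _, f, H, .emit hs h => by
      rw [Tail.pmap]
      exact .emit (H _ _ _ hs) (h.pmap _ fun _ _ _ => H _ _ _)
  | _, _, _, _, _, _, _, f, H, .nu h => by
      rw [Tail.pmap]
      refine .nu (h.pmap _ ?_)
      rintro _ _ _ (hvw | _)
      · exact .some (H _ _ _ hvw)
      · exact .none
  | _, _, _, _, _, _, _, f, H, .spawn h' h => by
      rw [Tail.pmap]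
      exact .spawn (h'.pmap _ fun _ _ _ => H _ _ _) (h.pmap _ fun _ _ _ => H _ _ _)
  | _, _, _, _, _, _, _, f, H, .present hs h hτ h' => by
      rw [Tail.pmap, Handlers.pmap_branch, Branch.pmap]
      exact .present (H _ _ _ hs) (h.pmap _ fun _ _ _ => H _ _ _)
        (hτ.pmap _ fun _ _ _ => H _ _ _) (h'.pmap _ fun _ _ _ => H _ _ _)
  | _, _, _, _, _, _, _, f, H, .awaitCall hs h hτ => by
      rw [Tail.pmap]
      exact .awaitCall (H _ _ _ hs) (h.mono fun _ _ => H _ _ _) (hτ.mono fun _ _ => H _ _ _)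
  | _, _, _, _, _, _, _, f, H, .cpsCall ha h hτ => by
      rw [Tail.pmap]
      exact .cpsCall (fun i => H _ _ _ (ha i)) (h.mono fun _ _ => H _ _ _)
        (hτ.mono fun _ _ => H _ _ _)

theorem RepresentsHandlers.pmap : ∀ {V W W' : Type} {ρ : V → W → Prop} {ρ' : V → W' → Prop}
    {K : Stack Id V} {τ : Handlers (CpsId Id) W} (f : ∀ w, w ∈ τ.names → W'),
    (∀ v w hw, ρ v w → ρ' v (f w hw)) → RepresentsHandlers ρ K τ →
      RepresentsHandlers ρ' K (τ.pmap f)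
  | _, _, _, _, _, _, _, _, _, .nil => by rw [Handlers.pmap]; exact .nil
  | _, _, _, _, _, _, _, f, H, .skip h => .skip (h.pmap f H)
  | _, _, _, _, _, _, _, f, H, .snoc hs h ht => by
      rw [Handlers.pmap]
      exact .snoc (H _ _ _ hs) (h.pmap _ fun _ _ _ => H _ _ _) (ht.pmap _ fun _ _ _ => H _ _ _)

end

theorem Represents.map_right {V W W' : Type} {ρ : V → W' → Prop} {K : Stack Id V}
    {u : Tail (CpsId Id) W} (f : W → W') (h : Represents (fun v w => ρ v (f w)) K u) :
    Represents ρ K (u.map f) :=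
  u.pmap_eq_map f ▸ h.pmap _ fun _ _ _ => id

theorem RepresentsHandlers.map_right {V W W' : Type} {ρ : V → W' → Prop} {K : Stack Id V}
    {τ : Handlers (CpsId Id) W} (f : W → W')
    (h : RepresentsHandlers (fun v w => ρ v (f w)) K τ) : RepresentsHandlers ρ K (τ.map f) :=
  τ.pmap_eq_map f ▸ h.pmap _ fun _ _ _ => id

theorem Represents.map {V V' W W' : Type} {ρ : V → W → Prop} {ρ' : V' → W' → Prop}
    {K : Stack Id V} {u : Tail (CpsId Id) W} (f : V → V') (g : W → W')
    (hρ : ∀ v w, ρ v w → ρ' (f v) (g w)) (h : Represents ρ K u) :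
    Represents ρ' (K.map f) (u.map g) :=
  (h.map_left f fun v _ w _ => hρ v w).map_right g

theorem RepresentsHandlers.map {V V' W W' : Type} {ρ : V → W → Prop} {ρ' : V' → W' → Prop}
    {K : Stack Id V} {τ : Handlers (CpsId Id) W} (f : V → V') (g : W → W')
    (hρ : ∀ v w, ρ v w → ρ' (f v) (g w)) (h : RepresentsHandlers ρ K τ) :
    RepresentsHandlers ρ' (K.map f) (τ.map g) :=
  (h.map_left f fun v _ w _ => hρ v w).map_right g

theorem Represents.await_cps {V W : Type} {ρ : V → W → Prop} {K : Stack Id V} {v : V} {w : W}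
    {t : Tail (CpsId Id) W} {τ : Handlers (CpsId Id) W} (hs : ρ v w) (h : Represents ρ K t)
    (hτ : RepresentsHandlers ρ K τ) : Represents ρ (.inl (.await v) :: K) (cps (.await w) t τ) := by
  rw [cps, SL.awaitCall]
  refine .present hs h hτ (.awaitCall ?_ (h.pmap _ ?_) (hτ.pmap _ ?_))
  · rwa [get_pos]
  all_goals exact fun _ _ _ hvw => by rwa [get_pos]

theorem Represents.call_cps {V W : Type} {ρ : V → W → Prop} {K : Stack Id V} {k : ℕ} {A : Id k}
    {a : Fin k → V} {c : Fin k → W} {t : Tail (CpsId Id) W} {τ : Handlers (CpsId Id) W}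
    (ha : ∀ i, ρ (a i) (c i)) (h : Represents ρ K t) (hτ : RepresentsHandlers ρ K τ) :
    Represents ρ (.inl (.call A a) :: K) (cps (.call A c) t τ) := by
  rw [cps, SL.cpsCall]
  refine .cpsCall (fun i => ?_) (h.pmap _ ?_) (hτ.pmap _ ?_)
  · rw [Fin.append_left]
    exact ha i
  all_goals exact fun _ _ _ hvw => by rwa [Fin.append_right, get_pos]

theorem represents_cps : ∀ {X V W : Type} {ρ : V → W → Prop} {a : X → V} {c : X → W}
    (T : Thread Id X), (∀ x, ρ (a x) (c x)) → ∀ {K : Stack Id V} {t : Tail (CpsId Id) W}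
    {τ : Handlers (CpsId Id) W}, Represents ρ K t → RepresentsHandlers ρ K τ →
      Represents ρ (.inl (T.map a) :: K) (cps (T.map c) t τ)
  | _, _, _, _, _, _, .zero, _, _, _, _, h, _ => by
      rw [Thread.map, Thread.map, cps]
      exact .zero h
  | _, _, _, _, _, _, .seq T₁ T₂, hac, _, _, _, h, hτ => by
      rw [Thread.map, Thread.map, cps]
      exact .seq (represents_cps T₁ hac (represents_cps T₂ hac h hτ) (.skip hτ))
  | _, _, _, _, _, _, .emit x, hac, _, _, _, h, _ => by
      rw [Thread.map, Thread.map, cps]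
      exact .emit (hac x) h
  | _, _, _, ρ, a, c, .nu T, hac, _, _, _, h, hτ => by
      rw [Thread.map, Thread.map, cps]
      refine .nu (represents_cps (ρ := Option.Rel ρ) T ?_ (h.map some some fun _ _ => .some)
        (hτ.map some some fun _ _ => .some))
      rintro (_ | x)
      · exact .none
      · exact .some (hac x)
  | _, _, _, _, _, _, .spawn T, hac, _, _, _, h, _ => by
      rw [Thread.map, Thread.map, cps]
      exact .spawn (represents_cps T hac .nil .nil) h
  | _, _, _, _, _, _, .await x, hac, _, _, _, h, hτ => .await_cps (hac x) h hτ
  | _, _, _, _, _, _, .watch x T, hac, _, _, _, h, hτ => by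
      rw [Thread.map, Thread.map, cps]
      exact .watch (represents_cps T hac (.leave h) (.snoc (hac x) hτ h))
  | _, _, _, _, _, _, .call _ args, hac, _, _, _, h, hτ => .call_cps (fun i => hac (args i)) h hτ

section Unfolding

variable {V W : Type} {ρ : V → W → Prop} {K : Stack Id V} {m : ℕ}
  {t : Tail (CpsId Id) (Fin m)} {τ : Handlers (CpsId Id) (Fin m)}
  (eqn : (n : ℕ) → Id n → Thread Id (Fin n))

theorem Represents.unfold_cps {k : ℕ} {A : Id k} {a : Fin k → V} {args : Fin (k + m) → W}
    (ha : ∀ i, ρ (a i) (args (Fin.castAdd m i)))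
    (h : Represents (fun v i => ρ v (args (Fin.natAdd k i))) K t)
    (hτ : RepresentsHandlers (fun v i => ρ v (args (Fin.natAdd k i))) K τ) :
    Represents ρ (.inl ((eqn k A).map a) :: K) ((cpsEqn eqn (k + m) (.cps A t τ)).map args) := by
  rw [cpsEqn]
  exact .map_right args
    (represents_cps (ρ := fun v i => ρ v (args i)) _ ha (h.map_right (Fin.natAdd k))
      (hτ.map_right (Fin.natAdd k)))

theorem Represents.unfold_await {v : V} {s : Fin m} {args : Fin m → W} (hs : ρ v (args s))
    (h : Represents (fun v i => ρ v (args i)) K t)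
    (hτ : RepresentsHandlers (fun v i => ρ v (args i)) K τ) :
    Represents ρ (.inl (.await v) :: K) ((cpsEqn eqn m (.await s t τ)).map args) := by
  rw [cpsEqn]
  exact .map_right args (.present hs h hτ (.awaitCall hs h hτ))

end Unfolding

end Representation

/-! ### Reduction in the context of a stack -/

section StackReduction

variable {Id : ℕ → Type}

section Represents

variable {V W : Type} {ρ : V → W → Prop} {u : Tail (CpsId Id) W}

theorem represents_seq_iff {T U : Thread Id V} {K : Stack Id V} :
    Represents ρ (.inl (.seq T U) :: K) u ↔ Represents ρ (.inl T :: .inl U :: K) u :=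
  ⟨fun | .seq h => h, .seq⟩

theorem represents_watch_iff {v : V} {T : Thread Id V} {K : Stack Id V} :
    Represents ρ (.inl (.watch v T) :: K) u ↔ Represents ρ (.inl T :: .inr v :: K) u :=
  ⟨fun | .watch h => h, .watch⟩

theorem represents_ctx_plug_iff {C : Thread.Ctx Id V} {T : Thread Id V} {K : Stack Id V} :
    Represents ρ (.inl (C.plug T) :: K) u ↔ Represents ρ (.inl T :: C.stack K) u := by
  induction C generalizing K with
  | hole => rfl
  | seq C U ih => exact represents_seq_iff.trans ih
  | watch v C ih => exact represents_watch_iff.trans ih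

theorem Represents.plug : ∀ {K : Stack Id V} {T : Thread Id V}, Represents ρ (.inl T :: K) u →
    Represents ρ [.inl (K.plug T)] u
  | [], _, h => h
  | .inl _ :: K, _, h => Represents.plug (K := K) (.seq h)
  | .inr _ :: K, _, h => Represents.plug (K := K) (.watch h)

end Represents

section Steps

variable {S : Type} {eqn : (n : ℕ) → Id n → Thread Id (Fin n)} {E E' : Env S}
  {P : Multiset (Thread Id S)} {T T' U : Thread Id S}

theorem Thread.Step.seq (h : Thread.Step eqn T E P T' E') (U : Thread Id S) :
    Thread.Step eqn (.seq T U) E P (.seq T' U) E' := by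
  obtain ⟨C, h⟩ := h
  exact .ctx (.seq C U) h

theorem Thread.Step.watch (h : Thread.Step eqn T E P T' E') (s : S) :
    Thread.Step eqn (.watch s T) E P (.watch s T') E' := by
  obtain ⟨C, h⟩ := h
  exact .ctx (.watch s C) h

theorem Thread.RedexStep.step (h : Thread.RedexStep eqn T E P T' E') :
    Thread.Step eqn T E P T' E' :=
  .ctx .hole h

theorem Thread.Step.plug : ∀ (K : Stack Id S) {T T' : Thread Id S},
    Thread.Step eqn T E P T' E' → Thread.Step eqn (K.plug T) E P (K.plug T') E'
  | [], _, _, h => h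
  | .inl U :: K, _, _, h => (h.seq U).plug K
  | .inr s :: K, _, _, h => (h.watch s).plug K

theorem Thread.Step.exists_redex (h : Thread.Step eqn T E P T' E') :
    ∃ C D D', T = Thread.Ctx.plug C D ∧ T' = C.plug D' ∧ Thread.RedexStep eqn D E P D' E' := by
  obtain ⟨C, h⟩ := h
  exact ⟨C, _, _, rfl, rfl, h⟩

theorem Thread.irreducible_zero : Irreducible (highLevel S eqn) E .zero := by
  intro P T' E' h
  obtain ⟨C, D, D', hT, -, hD⟩ := h.exists_redex
  cases C <;> cases hT
  cases hD

theorem Thread.irreducible_await {s : S} (hs : E s ≠ some true) :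
    Irreducible (highLevel S eqn) E (.await s) := by
  intro P T' E' h
  obtain ⟨C, D, D', hT, -, hD⟩ := h.exists_redex
  cases C <;> cases hT
  cases hD
  contradiction

theorem Thread.irreducible_seq (hT : Irreducible (highLevel S eqn) E T) (h0 : T ≠ .zero) :
    Irreducible (highLevel S eqn) E (.seq T U) := by
  intro P T' E' h
  obtain ⟨C, D, D', hTU, -, hD⟩ := h.exists_redex
  cases C <;> cases hTU
  · cases hD
    contradiction
  · exact hT _ _ _ (.ctx _ hD)

theorem Thread.irreducible_watch {s : S} (hT : Irreducible (highLevel S eqn) E T)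
    (h0 : T ≠ .zero) : Irreducible (highLevel S eqn) E (.watch s T) := by
  intro P T' E' h
  obtain ⟨C, D, D', hsT, -, hD⟩ := h.exists_redex
  cases C <;> cases hsT
  · cases hD
    contradiction
  · exact hT _ _ _ (.ctx _ hD)

theorem Stack.irreducible_plug : ∀ (K : Stack Id S) {T : Thread Id S},
    Irreducible (highLevel S eqn) E T → T ≠ .zero → Irreducible (highLevel S eqn) E (K.plug T)
  | [], _, hT, _ => hT
  | .inl _ :: K, _, hT, h0 => Stack.irreducible_plug K (Thread.irreducible_seq hT h0) nofun
  | .inr _ :: K, _, hT, h0 => Stack.irreducible_plug K (Thread.irreducible_watch hT h0) nofun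

end Steps

section Normalization

variable {S : Type} (eqn : (n : ℕ) → Id n → Thread Id (Fin n))

/-- Steps without any interaction, possible in every environment, such as those that remove a
completed `0; [ ]` or `watch s 0`: the translation does not mirror them. -/
def Silent (T T' : Thread Id S) : Prop := ∀ E : Env S, Thread.Step eqn T E 0 T' E

variable {eqn} in
theorem Irreducible.eq_of_silent {E : Env S} {T T' : Thread Id S}
    (hT : Irreducible (highLevel S eqn) E T) (h : Relation.ReflTransGen (Silent eqn) T T') :
    T = T' :=
  h.cases_head.resolve_right fun ⟨_, hstep, _⟩ => hT _ _ _ (hstep E)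

variable {eqn} in
theorem ThreadSteps.of_silent {T T' : Thread Id S} (h : Relation.ReflTransGen (Silent eqn) T T')
    (E : Env S) : ThreadSteps (highLevel S eqn) T E 0 T' E := by
  induction h using Relation.ReflTransGen.head_induction_on with
  | refl => exact .refl
  | head hstep _ ih => exact .trans (.single (hstep E)) ih

theorem Stack.silent_plug_zero :
    ∀ K : Stack Id S, Relation.ReflTransGen (Silent eqn) (K.plug .zero) K.thread
  | [] => .refl
  | .inl T :: K => .single fun E => (Thread.RedexStep.zero_seq T E).step.plug K
  | .inr _ :: _ => .refl

/-- Stacks that are empty or start with a thread other than `0`, `T; T'` and `watch s T`: on these,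
a translation starts with the instruction of that thread. -/
def Stack.Normal : Stack Id S → Prop
  | [] => True
  | .inl .zero :: _ => False
  | .inl (.seq _ _) :: _ => False
  | .inl (.watch _ _) :: _ => False
  | .inl _ :: _ => True
  | .inr _ :: _ => False

theorem Represents.exists_normal {W : Type} {ρ : S → W → Prop} :
    ∀ {K : Stack Id S} {u : Tail (CpsId Id) W}, Represents ρ K u →
      ∃ K' : Stack Id S, Relation.ReflTransGen (Silent eqn) K.thread K'.thread ∧
        Represents ρ K' u ∧ K'.Normal
  | _, _, .nil => ⟨[], .refl, .nil, trivial⟩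
  | _, _, .zero (K := K) h => by
      obtain ⟨K', hK, h⟩ := h.exists_normal
      exact ⟨K', (K.silent_plug_zero eqn).trans hK, h⟩
  | _, _, .seq h => h.exists_normal
  | _, _, .watch h => h.exists_normal
  | _, _, .leave (K := K) (v := v) h => by
      obtain ⟨K', hK, h⟩ := h.exists_normal
      refine ⟨K', .head (b := K.plug .zero) (fun E => ?_) ((K.silent_plug_zero eqn).trans hK), h⟩
      exact (Thread.RedexStep.watch_zero v E).step.plug K
  | _, _, .emit hs h => ⟨_, .refl, .emit hs h, trivial⟩
  | _, _, .nu h => ⟨_, .refl, .nu h, trivial⟩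
  | _, _, .spawn h' h => ⟨_, .refl, .spawn h' h, trivial⟩
  | _, _, .present hs h hτ h' => ⟨_, .refl, .present hs h hτ h', trivial⟩
  | _, _, .awaitCall hs h hτ => ⟨_, .refl, .awaitCall hs h hτ, trivial⟩
  | _, _, .cpsCall ha h hτ => ⟨_, .refl, .cpsCall ha h hτ, trivial⟩

variable {ρ : S → S → Prop}

theorem Represents.exists_present {K : Stack Id S} {v : S} {u : Tail (CpsId Id) S}
    (h : Represents ρ (.inl (.await v) :: K) u) (F : Env S) :
    ∃ w t τ u', ThreadSteps (tailRec S (cpsEqn eqn)) u F 0 (.present w t (τ.branch (.ret u'))) F ∧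
      ρ v w ∧ Represents ρ K t ∧ RepresentsHandlers ρ K τ ∧
      Represents ρ (.inl (.await v) :: K) u' := by
  cases h with
  | present hs h hτ h' => exact ⟨_, _, _, _, .refl, hs, h, hτ, h'⟩
  | @awaitCall _ _ _ _ _ _ s t τ args hs h hτ =>
    have hpresent := Represents.unfold_await eqn hs h hτ
    have hcall := Tail.Step.call (eqn := cpsEqn eqn) (.await s t τ) args F
    rw [cpsEqn, Tail.map] at hpresent hcall
    generalize Branch.map args _ = b at hpresent hcall
    cases hpresent with
    | present hs h hτ h' => exact ⟨_, _, _, _, .single hcall, hs, h, hτ, h'⟩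

end Normalization

theorem RepresentsHandlers.endInstant_plug {S : Type} {ρ : S → S → Prop} {E F : Env S}
    (hEF : ∀ v w, ρ v w → E v = F w) :
    ∀ {K : Stack Id S} {τ : Handlers (CpsId Id) S} {T : Thread Id S} {b : Branch (CpsId Id) S},
      RepresentsHandlers ρ K τ → Represents ρ (.inl (T.endInstant E) :: K) (b.eval F) →
        Represents ρ [.inl ((K.plug T).endInstant E)] ((τ.branch b).eval F)
  | _, _, _, _, .nil, h => h
  | _, _, _, _, .skip hτ, h => hτ.endInstant_plug hEF (.seq h)
  | _, _, T, b, .snoc (v := v) (w := w) (t := t) hs hτ ht, h => by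
      refine hτ.endInstant_plug (T := .watch v T) (b := .ite w (.ret t) b) hEF ?_
      rw [Thread.endInstant, Branch.eval, hEF v w hs]
      split
      · exact .zero ht
      · exact .watch h

end StackReduction

/-! ### Corresponding environments -/

section Environments

variable {S : Type} {J : Set S} {ρ : S → S → Prop} {E F : Env S}

theorem Env.set_self (E : Env S) (s : S) (b : Bool) : E.set s b s = some b :=
  open Classical in Function.update_self ..

theorem Env.set_of_ne (E : Env S) {s s' : S} (h : s' ≠ s) (b : Bool) : E.set s b s' = E s' :=
  open Classical in Function.update_of_ne h ..

theorem Env.set_ne_none (E : Env S) {s s' : S} (b : Bool) (h : E s' ≠ none) :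
    E.set s b s' ≠ none := by
  obtain rfl | hs := eq_or_ne s' s
  · rw [Env.set_self]
    exact Option.some_ne_none b
  · rwa [Env.set_of_ne E hs]

theorem Env.infinite_set {E : Env S} (h : {s | E s = none}.Infinite) (s : S) (b : Bool) :
    {s' | E.set s b s' = none}.Infinite := by
  refine (h.sdiff (Set.finite_singleton s)).mono ?_
  rintro s' ⟨hs', hne⟩
  exact (Env.set_of_ne E hne b).trans hs'

/-- The environments `E` and `F` agree up to the correspondence `ρ` between the names known to the
source program and those known to its translation. The two programs generate different names, but
they share the names in `J`. -/
structure EnvRel (J : Set S) (ρ : S → S → Prop) (E F : Env S) : Prop where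
  biUnique : Relator.BiUnique ρ
  refl : ∀ s ∈ J, ρ s s
  eq : ∀ v w, ρ v w → E v = F w
  ne_none : ∀ v w, ρ v w → E v ≠ none
  infinite_left : {s | E s = none}.Infinite
  infinite_right : {s | F s = none}.Infinite

/-- The correspondence `ρ`, extended to the names `s` and `s'` generated by `ν`. -/
def AddPair {V W : Type} (ρ : V → W → Prop) (s : V) (s' : W) : V → W → Prop :=
  fun v w => ρ v w ∨ v = s ∧ w = s'

theorem EnvRel.set (h : EnvRel J ρ E F) {v w : S} (hvw : ρ v w) (b : Bool) :
    EnvRel J ρ (E.set v b) (F.set w b) where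
  biUnique := h.biUnique
  refl := h.refl
  eq v' w' hvw' := by
    obtain rfl | hv := eq_or_ne v' v
    · rw [h.biUnique.2 hvw' hvw, Env.set_self, Env.set_self]
    · have hw : w' ≠ w := fun hw => hv (h.biUnique.1 hvw' (hw ▸ hvw))
      rw [Env.set_of_ne E hv, Env.set_of_ne F hw, h.eq v' w' hvw']
  ne_none v' w' hvw' := Env.set_ne_none E b (h.ne_none v' w' hvw')
  infinite_left := Env.infinite_set h.infinite_left v b
  infinite_right := Env.infinite_set h.infinite_right w b

theorem EnvRel.set_fresh (h : EnvRel J ρ E F) {s s' : S} (hs : E s = none) (hs' : F s' = none)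
    (b : Bool) : EnvRel J (AddPair ρ s s') (E.set s b) (F.set s' b) := by
  have hne : ∀ {v w}, ρ v w → v ≠ s := by
    rintro v w hvw rfl
    exact h.ne_none v w hvw hs
  have hne' : ∀ {v w}, ρ v w → w ≠ s' := by
    rintro v w hvw rfl
    exact h.ne_none v w hvw ((h.eq v w hvw).trans hs')
  refine ⟨⟨?_, ?_⟩, fun v hv => .inl (h.refl v hv), ?_, ?_, Env.infinite_set h.infinite_left s b,
    Env.infinite_set h.infinite_right s' b⟩
  · rintro v w v' (hvw | ⟨rfl, rfl⟩) (hvw' | ⟨rfl, hw⟩)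
    exacts [h.biUnique.1 hvw hvw', (hne' hvw hw).elim, (hne' hvw' rfl).elim, rfl]
  · rintro v w w' (hvw | ⟨rfl, rfl⟩) (hvw' | ⟨hv, rfl⟩)
    exacts [h.biUnique.2 hvw hvw', (hne hvw hv).elim, (hne hvw' rfl).elim, rfl]
  · rintro v w (hvw | ⟨rfl, rfl⟩)
    · rw [Env.set_of_ne E (hne hvw), Env.set_of_ne F (hne' hvw), h.eq v w hvw]
    · rw [Env.set_self, Env.set_self]
  · rintro v w (hvw | ⟨rfl, rfl⟩)
    · exact Env.set_ne_none E b (h.ne_none v w hvw)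
    · rw [Env.set_self]
      exact Option.some_ne_none b

theorem Represents.instantiate {Id : ℕ → Type} {V W : Type} {ρ : V → W → Prop} {K : Stack Id V}
    {T : Thread Id (Option V)} {u : Tail (CpsId Id) (Option W)}
    (h : Represents (Option.Rel ρ) (.inl T :: K.map some) u) (s : V) (s' : W) :
    Represents (AddPair ρ s s') (.inl (T.map (·.getD s)) :: K) (u.map (·.getD s')) := by
  have hK : Stack.map (·.getD s) (K.map some) = K := (K.map_map _ _).trans K.map_id
  rw [← hK]
  refine h.map (·.getD s) (·.getD s') ?_
  rintro _ _ (hvw | _)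
  · exact .inl hvw
  · exact .inr ⟨rfl, rfl⟩

end Environments

/-! ### Simulation of threads -/

section ThreadSimulation

variable {S : Type} {Id : ℕ → Type} {eqn : (n : ℕ) → Id n → Thread Id (Fin n)} {J : Set S}
  {ρ : S → S → Prop} {E F : Env S} {K : Stack Id S} {u : Tail (CpsId Id) S}

theorem EnvRel.exists_tail_steps_of_redexStep (hE : EnvRel J ρ E F) {D D' : Thread Id S}
    {P : Multiset (Thread Id S)} {E' : Env S} (hD : Thread.RedexStep eqn D E P D' E')
    (h : Represents ρ (.inl D :: K) u) :
    ∃ Q u' F', ThreadSteps (tailRec S (cpsEqn eqn)) u F Q u' F' ∧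
      ∃ ρ' ≥ ρ, EnvRel J ρ' E' F' ∧ Represents ρ' (.inl D' :: K) u' ∧
        Multiset.Rel (fun T u => Represents ρ' [.inl T] u) P Q := by
  cases hD with
  | zero_seq =>
    rw [represents_seq_iff] at h
    cases h with
    | zero h => exact ⟨0, u, F, .refl, ρ, le_rfl, hE, h, .zero⟩
  | watch_zero =>
    rw [represents_watch_iff] at h
    cases h with
    | zero h =>
      cases h with
      | leave h => exact ⟨0, u, F, .refl, ρ, le_rfl, hE, .zero h, .zero⟩
  | emit =>
    cases h with
    | emit hs h =>
      exact ⟨0, _, _, .single (.emit _ _ F), ρ, le_rfl, hE.set hs true, .zero h, .zero⟩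
  | nu T s _ hs =>
    obtain ⟨s', hs'⟩ := hE.infinite_right.nonempty
    cases h with
    | nu h =>
      exact ⟨0, _, _, .single (.nu _ s' F hs'), AddPair ρ s s', fun _ _ => .inl,
        hE.set_fresh hs hs' false, h.instantiate s s', .zero⟩
  | call =>
    cases h with
    | cpsCall ha h hτ =>
      exact ⟨0, _, F, .single (.call _ _ F), ρ, le_rfl, hE, .unfold_cps eqn ha h hτ, .zero⟩
  | await v _ hv =>
    obtain ⟨w, t, τ, u', hsteps, hvw, h, -⟩ := h.exists_present eqn F
    have hpresent := Tail.Step.present (eqn := cpsEqn eqn) w t (τ.branch (.ret u')) F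
      ((hE.eq v w hvw).symm.trans hv)
    exact ⟨0, t, F, hsteps.trans (.single hpresent), ρ, le_rfl, hE, .zero h, .zero⟩
  | spawn =>
    cases h with
    | spawn h' h =>
      exact ⟨_, _, F, .single (.spawn _ _ F), ρ, le_rfl, hE, .zero h, .cons h' .zero⟩

theorem EnvRel.exists_thread_steps_of_tailStep (hE : EnvRel J ρ E F) (hK : K.Normal)
    (h : Represents ρ K u) {Q : Multiset (Tail (CpsId Id) S)} {u' : Tail (CpsId Id) S}
    {F' : Env S} (hu : Tail.Step (cpsEqn eqn) u F Q u' F') :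
    ∃ P T' E', ThreadSteps (highLevel S eqn) K.thread E P T' E' ∧
      ∃ ρ' ≥ ρ, EnvRel J ρ' E' F' ∧ Represents ρ' [.inl T'] u' ∧
        Multiset.Rel (fun u T => Represents ρ' [.inl T] u) Q P := by
  cases h with
  | nil => cases hu
  | zero | seq | watch | leave => exact hK.elim
  | emit hs h =>
    cases hu
    exact ⟨0, _, _, .single ((Thread.RedexStep.emit _ E).step.plug _), ρ, le_rfl,
      hE.set hs true, .plug (.zero h), .zero⟩
  | nu h =>
    obtain - | ⟨_, s', _, hs'⟩ := hu
    obtain ⟨s, hs⟩ := hE.infinite_left.nonempty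
    exact ⟨0, _, _, .single ((Thread.RedexStep.nu _ s E hs).step.plug _), AddPair ρ s s',
      fun _ _ => .inl, hE.set_fresh hs hs' false, .plug (h.instantiate s s'), .zero⟩
  | spawn h' h =>
    cases hu
    exact ⟨_, _, E, .single ((Thread.RedexStep.spawn _ E).step.plug _), ρ, le_rfl, hE,
      .plug (.zero h), .cons h' .zero⟩
  | present hs h hτ h' =>
    obtain - | - | - | ⟨_, _, _, _, hs'⟩ := hu
    have hawait := Thread.RedexStep.await (eqn := eqn) _ E ((hE.eq _ _ hs).trans hs')
    exact ⟨0, _, E, .single (hawait.step.plug _), ρ, le_rfl, hE, .plug (.zero h), .zero⟩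
  | awaitCall hs h hτ =>
    cases hu
    exact ⟨0, _, E, .refl, ρ, le_rfl, hE, .plug (.unfold_await eqn hs h hτ), .zero⟩
  | cpsCall ha h hτ =>
    cases hu
    exact ⟨0, _, E, .single ((Thread.RedexStep.call _ _ E).step.plug _), ρ, le_rfl, hE,
      .plug (.unfold_cps eqn ha h hτ), .zero⟩

theorem Stack.Normal.eq_nil_or_await (hK : K.Normal) (hE : ∃ s, E s = none)
    (hirr : Irreducible (highLevel S eqn) E K.thread) :
    K = [] ∨ ∃ v K', K = .inl (.await v) :: K' ∧ E v ≠ some true := by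
  have hredex : ∀ {D D' P E' K'}, K = .inl D :: K' → ¬ Thread.RedexStep eqn D E P D' E' := by
    rintro D D' P E' K' rfl hD
    exact hirr _ _ _ (hD.step.plug K')
  match K, hK with
  | [], _ => exact .inl rfl
  | .inl (.emit s) :: _, _ => exact (hredex rfl (.emit s E)).elim
  | .inl (.nu T) :: _, _ =>
    obtain ⟨s, hs⟩ := hE
    exact (hredex rfl (.nu T s E hs)).elim
  | .inl (.spawn T) :: _, _ => exact (hredex rfl (.spawn T E)).elim
  | .inl (.await v) :: K', _ => exact .inr ⟨v, K', rfl, fun hv => hredex rfl (.await v E hv)⟩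
  | .inl (.call A args) :: _, _ => exact (hredex rfl (.call A args E)).elim

theorem Tail.irreducible_zero {I : ℕ → Type 1} {eqn : (n : ℕ) → I n → Tail I (Fin n)} :
    Irreducible (tailRec S eqn) E .zero :=
  fun _ _ _ => nofun

theorem Tail.irreducible_present {I : ℕ → Type 1} {eqn : (n : ℕ) → I n → Tail I (Fin n)} {s : S}
    {t : Tail I S} {b : Branch I S} (hs : E s ≠ some true) :
    Irreducible (tailRec S eqn) E (.present s t b) := by
  rintro P t' E' ⟨⟩
  contradiction

theorem highLevel_isThreadSimulation (S : Type) (eqn : (n : ℕ) → Id n → Thread Id (Fin n))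
    (J : Set S) :
    IsThreadSimulation (highLevel S eqn) (tailRec S (cpsEqn eqn)) (EnvRel J)
      (fun ρ T u => Represents ρ [.inl T] u) where
  mono hρ h := h.mono hρ
  step hE h hT := by
    obtain ⟨C, D, D', rfl, rfl, hD⟩ := Thread.Step.exists_redex hT
    simp only [represents_ctx_plug_iff] at h ⊢
    exact hE.exists_tail_steps_of_redexStep hD h
  settle {ρ T u E F} hE h hT := by
    obtain ⟨K, hsilent, hu, hK⟩ := h.exists_normal eqn
    obtain rfl : T = K.thread := hT.eq_of_silent hsilent
    obtain rfl | ⟨v, K, rfl, hv⟩ := hK.eq_nil_or_await hE.infinite_left.nonempty hT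
    · cases hu
      exact ⟨.zero, .refl, Tail.irreducible_zero, .zero .nil⟩
    · obtain ⟨w, t, τ, u', hsteps, hvw, -, hτ, hu⟩ := hu.exists_present eqn F
      exact ⟨_, hsteps, Tail.irreducible_present (hE.eq v w hvw ▸ hv),
        hτ.endInstant_plug hE.eq hu⟩

theorem tailRec_isThreadSimulation (S : Type) (eqn : (n : ℕ) → Id n → Thread Id (Fin n))
    (J : Set S) :
    IsThreadSimulation (tailRec S (cpsEqn eqn)) (highLevel S eqn)
      (fun ρ F E => EnvRel J ρ E F) (fun ρ u T => Represents ρ [.inl T] u) where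
  mono hρ h := h.mono hρ
  step {ρ u u' T F F' E Q} hE h hu := by
    obtain ⟨K, hsilent, h, hK⟩ := h.exists_normal eqn
    obtain ⟨P, T', E', hsteps, h'⟩ := hE.exists_thread_steps_of_tailStep hK h hu
    exact ⟨P, T', E', (ThreadSteps.of_silent hsilent E).trans hsteps, h'⟩
  settle {ρ u T F E} hE h hu := by
    obtain ⟨K, hsilent, h, hK⟩ := h.exists_normal eqn
    refine ⟨K.thread, .of_silent hsilent E, ?_⟩
    cases h with
    | nil => exact ⟨Thread.irreducible_zero, .zero .nil⟩
    | zero | seq | watch | leave => exact hK.elim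
    | emit => exact (hu _ _ _ (.emit _ _ F)).elim
    | nu =>
      obtain ⟨s', hs'⟩ := hE.infinite_right.nonempty
      exact (hu _ _ _ (.nu _ s' F hs')).elim
    | spawn => exact (hu _ _ _ (.spawn _ _ F)).elim
    | awaitCall | cpsCall => exact (hu _ _ _ (.call _ _ F)).elim
    | present hs _ hτ h' =>
      have hv := hE.eq _ _ hs ▸ fun hw => hu _ _ _ (.present _ _ _ F hw)
      exact ⟨Stack.irreducible_plug _ (Thread.irreducible_await hv) nofun,
        hτ.endInstant_plug hE.eq h'⟩

end ThreadSimulation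

/-! ### Instants -/

section Instants

variable {S : Type} {Input Output : Set S} {Id : ℕ → Type}
  {eqn : (n : ℕ) → Id n → Thread Id (Fin n)}

/-- The programs `P` and `Q` correspond thread by thread, up to a correspondence between their names
that is the identity on `J`. -/
def ProgRel (J : Set S) (P : Multiset (Thread Id S)) (Q : Multiset (Tail (CpsId Id) S)) : Prop :=
  ∃ ρ : S → S → Prop, Relator.BiUnique ρ ∧ (∀ s ∈ J, ρ s s) ∧
    Multiset.Rel (fun T u => Represents ρ [.inl T] u) P Q

theorem progRel_cpsProg (J : Set S) (P : Multiset (Thread Id S)) : ProgRel J P (cpsProg P) := by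
  refine ⟨Eq, ⟨fun _ _ _ h h' => h.trans h'.symm, fun _ _ _ h h' => h.symm.trans h'⟩,
    fun _ _ => rfl, ?_⟩
  rw [cpsProg, Multiset.rel_map_right]
  refine Multiset.rel_refl_of_refl_on fun T _ => ?_
  simpa only [Thread.map_id] using represents_cps T (a := id) (c := id) (fun _ => rfl) .nil .nil

theorem EnvRel.progRel {J : Set S} {ρ : S → S → Prop} {E F : Env S} (hE : EnvRel J ρ E F)
    {P : Multiset (Thread Id S)} {Q : Multiset (Tail (CpsId Id) S)}
    (hPQ : Multiset.Rel (fun T u => Represents ρ [.inl T] u) P Q) : ProgRel J P Q :=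
  ⟨ρ, hE.biUnique, hE.refl, hPQ⟩

theorem finite_sigProg (L : Language S) (P : Multiset L.Thr) : (sigProg L P).Finite := by
  refine (P.bind fun T => (L.names T : Multiset S)).finite_toSet.subset ?_
  rintro s ⟨T, hT, hs⟩
  exact Multiset.mem_bind.2 ⟨T, hT, hs⟩

theorem initEnv_eq_none_iff {L : Language S} {I : Set S} (hI : I ⊆ Input) {P : Multiset L.Thr}
    {s : S} : initEnv L Input Output I P s = none ↔ s ∉ Input ∪ Output ∪ sigProg L P := by
  rw [initEnv]
  split_ifs with h₁ h₂
  · simpa only [reduceCtorEq, false_iff, not_not] using .inl (.inl (hI h₁))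
  · simpa only [reduceCtorEq, false_iff, not_not] using h₂
  · simpa only [true_iff] using h₂

theorem infinite_initEnv_eq_none (hInt : (Input ∪ Output)ᶜ.Infinite) {L : Language S} {I : Set S}
    (hI : I ⊆ Input) (P : Multiset L.Thr) :
    {s | initEnv L Input Output I P s = none}.Infinite := by
  refine (hInt.sdiff (finite_sigProg L P)).mono ?_
  rintro s ⟨h₁, h₂⟩
  exact (initEnv_eq_none_iff hI).2 fun h => h.elim h₁ h₂

theorem initEnv_eq_initEnv {L L' : Language S} {I : Set S} (hI : I ⊆ Input) {P : Multiset L.Thr}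
    {Q : Multiset L'.Thr} {ρ : S → S → Prop} (hρ : Relator.BiUnique ρ)
    (hrefl : ∀ s ∈ Input, ρ s s) {v w : S} (hvw : ρ v w)
    (hv : v ∈ Input ∪ Output ∪ sigProg L P) (hw : w ∈ Input ∪ Output ∪ sigProg L' Q) :
    initEnv L Input Output I P v = initEnv L' Input Output I Q w := by
  have hiff : v ∈ I ↔ w ∈ I :=
    ⟨fun h => hρ.2 (hrefl v (hI h)) hvw ▸ h, fun h => hρ.1 (hrefl w (hI h)) hvw ▸ h⟩
  classical
  rw [initEnv, initEnv, if_pos hv, if_pos hw]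
  exact if_congr hiff rfl rfl

theorem ProgRel.exists_envRel_initEnv (hInt : (Input ∪ Output)ᶜ.Infinite)
    {P : Multiset (Thread Id S)} {Q : Multiset (Tail (CpsId Id) S)}
    (h : ProgRel (Input ∪ Output) P Q) {I : Set S} (hI : I ⊆ Input) :
    ∃ ρ, EnvRel (Input ∪ Output) ρ (initEnv (highLevel S eqn) Input Output I P)
        (initEnv (tailRec S (cpsEqn eqn)) Input Output I Q) ∧
      Multiset.Rel (fun T u => Represents ρ [.inl T] u) P Q := by
  obtain ⟨ρ, hρ, hrefl, hPQ⟩ := h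
  let A := Input ∪ Output ∪ sigProg (highLevel S eqn) P
  let B := Input ∪ Output ∪ sigProg (tailRec S (cpsEqn eqn)) Q
  refine ⟨fun v w => ρ v w ∧ v ∈ A ∧ w ∈ B, ⟨⟨?_, ?_⟩, ?_, ?_, ?_,
    infinite_initEnv_eq_none (L := highLevel S eqn) hInt hI P,
    infinite_initEnv_eq_none (L := tailRec S (cpsEqn eqn)) hInt hI Q⟩, ?_⟩
  · exact fun _ _ _ h h' => hρ.1 h.1 h'.1
  · exact fun _ _ _ h h' => hρ.2 h.1 h'.1
  · exact fun s hs => ⟨hrefl s hs, .inl hs, .inl hs⟩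
  · exact fun v w h => initEnv_eq_initEnv hI hρ (fun s hs => hrefl s (.inl hs)) h.1 h.2.1 h.2.2
  · exact fun v w h => (initEnv_eq_none_iff hI).not.2 (not_not.2 h.2.1)
  · refine hPQ.mono fun T hT u hu h => ?_
    rw [← Stack.map_id [.inl T]]
    refine h.map_left id fun v hv w hw hvw => ⟨hvw, .inr ⟨T, hT, ?_⟩, .inr ⟨u, hu, hw⟩⟩
    simpa only [Stack.names, List.append_nil, id] using hv

theorem isSimulation_progRel (hInt : (Input ∪ Output)ᶜ.Infinite) :
    IsSimulation (highLevel S eqn) (tailRec S (cpsEqn eqn)) Input Output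
      (ProgRel (Input ∪ Output)) :=
  (highLevel_isThreadSimulation S eqn (Input ∪ Output)).isSimulation
    (fun hPQ hI => hPQ.exists_envRel_initEnv hInt hI)
    (fun hE hs => hE.eq _ _ (hE.refl _ (.inr hs)))
    fun hE hPQ => hE.progRel hPQ

theorem isSimulation_flip_progRel (hInt : (Input ∪ Output)ᶜ.Infinite) :
    IsSimulation (tailRec S (cpsEqn eqn)) (highLevel S eqn) Input Output
      (flip (ProgRel (Input ∪ Output))) := by
  refine (tailRec_isThreadSimulation S eqn (Input ∪ Output)).isSimulation ?_ ?_ ?_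
  · intro Q P I hPQ hI
    obtain ⟨ρ, hE, hrel⟩ := ProgRel.exists_envRel_initEnv hInt hPQ hI
    exact ⟨ρ, hE, Multiset.rel_flip.2 hrel⟩
  · exact fun hE hs => (hE.eq _ _ (hE.refl _ (.inr hs))).symm
  · exact fun hE hrel => hE.progRel (Multiset.rel_flip.1 hrel)

end Instants

end SL

theorem mainTheorem4_general {S : Type} (Input Output : Set S)
    (hInt : (Input ∪ Output)ᶜ.Infinite)
    {Id : ℕ → Type} (eqn : (n : ℕ) → Id n → SL.Thread Id (Fin n))
    (P : Multiset (SL.Thread Id S)) :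
    SL.tr (SL.highLevel S eqn) Input Output P =
      SL.tr (SL.tailRec S (SL.cpsEqn eqn)) Input Output (SL.cpsProg P) :=
  (SL.isSimulation_progRel hInt).tr_eq (SL.isSimulation_flip_progRel hInt)
    (SL.progRel_cpsProg (Input ∪ Output) P)

theorem mainTheorem4 {S : Type} [Countable S] (Input Output : Set S)
    (hInt : (Input ∪ Output)ᶜ.Infinite)
    {Id : ℕ → Type} (eqn : (n : ℕ) → Id n → SL.Thread Id (Fin n))
    (P : Multiset (SL.Thread Id S)) (hP : P ≠ 0) :
    SL.tr (SL.highLevel S eqn) Input Output P =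
      SL.tr (SL.tailRec S (SL.cpsEqn eqn)) Input Output (SL.cpsProg P) :=
  mainTheorem4_general Input Output hInt eqn P
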